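/- **Theorem (Conditional Leibniz rule in $BV^{\alpha,\infty}_{\mathrm{loc}}$).** Let $n\ge 1$, $\alpha\in(0,1)$ and $$\mu_{n,\alpha}=2^\alpha\pi^{-n/2}\,\frac{\Gamma\left(\frac{n+\alpha+1}{2}\right)}{\Gamma\left(\frac{1-\alpha}{2}\right)}.$$ For $\varphi\in C^\infty_c(\mathbb R^n;\mathbb R^n)$ and $g\in L^\infty(\mathbb R^n)$ let $$\mathrm{div}^\alpha\varphi(x)=\mu_{n,\alpha}\int_{\mathbb R^n}\frac{(\varphi(y)-\varphi(x))\cdot(y-x)}{|y-x|^{n+\alpha+1}}\,dy,$$ $$\mathrm{div}^\alpha_{\mathrm{NL}}(g,\varphi)(x)=\mu_{n,\alpha}\int_{\mathbb R^n}\frac{(g(y)-g(x))(\varphi(y)-\varphi(x))\cdot(y-x)}{|y-x|^{n+\alpha+1}}\,dy .$$ Let $\mathscr M_{\mathrm{loc}}(\mathbb R^n;\mathbb R^n)$ be the space of $\mathbb R^n$-valued Radon measures $\mu$ with locally finite total variation $|\mu|$. We write $f\in BV^{\alpha,\infty}_{\mathrm{loc}}(\mathbb R^n)$ if $f\in L^\infty(\mathbb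 R^n)$ and, for every bounded open set $A\subset\mathbb R^n$, $$\sup\Big\{\int_{\mathbb R^n} f\,\mathrm{div}^\alpha\varphi\,dx:\ \varphi\in C^\infty_c(\mathbb R^n;\mathbb R^n),\ \|\varphi\|_{L^\infty}\le1,\ \mathrm{supp}\,\varphi\subset A\Big\}<+\infty .$$ For such $f$ there is a unique measure $D^\alpha f\in\mathscr M_{\mathrm{loc}}(\mathbb R^n;\mathbb R^n)$ with $\int f\,\mathrm{div}^\alpha\varphi\,dx=-\int\varphi\cdot dD^\alpha f$ for all $\varphi\in C^\infty_c(\mathbb R^n;\mathbb R^n)$. For $f,g\in L^\infty(\mathbb R^n)$, we say that the non-local gradient measure $D^\alpha_{\mathrm{NL}}(f,g)$ exists if there is a (necessarily unique) measure $D^\alpha_{\mathrm{NL}}(f,g)\in\mathscr M_{\mathrm{loc}}(\mathbb R^n;\mathbb R^n)$ with $$\int_{\mathbb R^n} f\,\mathrm{div}^\alpha_{\mathrm{NL}}(g,\varphi)\,dx=\int_{\mathbb R^n}\varphi\cdot dD^\alpha_{\mathrm{NL}}(f,g)\qquad\text{for all }\varphi\in C^\infty_c(\mathbb R^n;\mathbb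 R^n).$$ Finally, for $u\in L^1_{\mathrm{loc}}(\mathbb R^n)$, let $\mathscr R_u$ be the set of points $x$ at which the limit $u^\star(x)=\lim_{r\to0^+}\frac1{|B_r(x)|}\int_{B_r(x)}u\,dy$ exists in $\mathbb R$. Let $f,g\in BV^{\alpha,\infty}_{\mathrm{loc}}(\mathbb R^n)$. Then $$fg\in BV^{\alpha,\infty}_{\mathrm{loc}}(\mathbb R^n)\iff D^\alpha_{\mathrm{NL}}(f,g)\ \text{exists in}\ \mathscr M_{\mathrm{loc}}(\mathbb R^n;\mathbb R^n).$$ Moreover, there exist $\bar f\in L^\infty(\mathbb R^n,|D^\alpha g|)$ and $\bar g\in L^\infty(\mathbb R^n,|D^\alpha f|)$ with $$\|\bar f\|_{L^\infty(\mathbb R^n,|D^\alpha g|)}\le\|f\|_{L^\infty(\mathbb R^n)},\qquad \|\bar g\|_{L^\infty(\mathbb R^n,|D^\alpha f|)}\le\|g\|_{L^\infty(\mathbb R^n)},$$ $$\bar f=f^\star\ \ |D^\alpha g|\text{-a.e. in }\mathscr R_f,\qquad \bar g=g^\star\ \ |D^\alpha f|\text{-a.e. in }\mathscr R_g,$$ such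 that, provided that $fg\in BV^{\alpha,\infty}_{\mathrm{loc}}(\mathbb R^n)$, $$D^\alpha(fg)=\bar f\,D^\alpha g+\bar g\,D^\alpha f+D^\alpha_{\mathrm{NL}}(f,g)\qquad\text{in }\mathscr M_{\mathrm{loc}}(\mathbb R^n;\mathbb R^n).$$ -/

import Mathlib

open MeasureTheory Set Filter Topology
open scoped ENNReal ContDiff RealInnerProductSpace

noncomputable section

namespace FracBV

/-- Euclidean space `ℝⁿ`. -/
abbrev Rn (n : ℕ) : Type := EuclideanSpace ℝ (Fin n)

/-- The normalization constant
`μ_{n,α} = 2 ^ α π ^ (-n/2) Γ((n + α + 1) / 2) / Γ((1 - α) / 2)`. -/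
def muConst (n : ℕ) (α : ℝ) : ℝ :=
  (2 : ℝ) ^ α * Real.pi ^ (-((n : ℝ) / 2)) *
    (Real.Gamma (((n : ℝ) + α + 1) / 2) / Real.Gamma ((1 - α) / 2))

/-- The fractional `α`-divergence of a vector field `φ`. -/
def fracDiv {n : ℕ} (α : ℝ) (φ : Rn n → Rn n) (x : Rn n) : ℝ :=
  muConst n α * ∫ y, ⟪φ y - φ x, y - x⟫ / ‖y - x‖ ^ ((n : ℝ) + α + 1)

/-- The non-local fractional `α`-divergence of the pair `(g, φ)`. -/
def fracDivNL {n : ℕ} (α : ℝ) (g : Rn n → ℝ) (φ : Rn n → Rn n) (x : Rn n) : ℝ :=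
  muConst n α *
    ∫ y, (g y - g x) * ⟪φ y - φ x, y - x⟫ / ‖y - x‖ ^ ((n : ℝ) + α + 1)

/-- `φ ∈ C_c^∞(ℝⁿ; ℝⁿ)`. -/
structure IsTestField {n : ℕ} (φ : Rn n → Rn n) : Prop where
  contDiff : ContDiff ℝ ∞ φ
  hasCompactSupport : HasCompactSupport φ

/-- `f ∈ BV^{α,p}_loc(ℝⁿ)`: `f ∈ L^p(ℝⁿ)` and, for each bounded open set `A`, the integrals of
`f div^α φ` over all test fields `φ` with `‖φ‖_∞ ≤ 1` and support in `A` are bounded above. -/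
def MemBVLoc {n : ℕ} (α : ℝ) (p : ℝ≥0∞) (f : Rn n → ℝ) : Prop :=
  MemLp f p volume ∧
    ∀ A : Set (Rn n), IsOpen A → Bornology.IsBounded A →
      BddAbove {t : ℝ | ∃ φ : Rn n → Rn n, IsTestField φ ∧ (∀ x, ‖φ x‖ ≤ 1) ∧
        tsupport φ ⊆ A ∧ t = ∫ x, f x * fracDiv α φ x}

/-- An `ℝⁿ`-valued Radon measure `μ ∈ ℳ_loc(ℝⁿ; ℝⁿ)`, given by its polar decomposition
`μ = σ |μ|`: `var = |μ|` is a locally finite positive Borel measure (the total variation) and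
`dir = σ` is a Borel field of unit vectors. -/
structure VecRadon (n : ℕ) where
  var : Measure (Rn n)
  locallyFinite : IsLocallyFiniteMeasure var
  dir : Rn n → Rn n
  measurable_dir : Measurable dir
  norm_dir : ∀ᵐ x ∂var, ‖dir x‖ = 1

/-- The value `μ(B)` on a bounded Borel set `B`. Two Radon measures are the same element of
`ℳ_loc(ℝⁿ; ℝⁿ)` exactly when these values agree for all bounded Borel sets `B`. -/
def VecRadon.val {n : ℕ} (μ : VecRadon n) (B : Set (Rn n)) : Rn n :=
  ∫ x in B, μ.dir x ∂μ.var

/-- The value `(h μ)(B) = ∫_B h dμ` on a bounded Borel set `B` of the Radon measure `h μ`, for a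
scalar function `h ∈ L^∞(ℝⁿ, |μ|)`. -/
def VecRadon.mulVal {n : ℕ} (h : Rn n → ℝ) (μ : VecRadon n) (B : Set (Rn n)) : Rn n :=
  ∫ x in B, h x • μ.dir x ∂μ.var

/-- The integral `∫ φ · dμ`. -/
def VecRadon.pairing {n : ℕ} (μ : VecRadon n) (φ : Rn n → Rn n) : ℝ :=
  ∫ x, ⟪φ x, μ.dir x⟫ ∂μ.var

/-- `μ` is the fractional `α`-variation measure `D^α f` of `f`. -/
def IsFracVariation {n : ℕ} (α : ℝ) (f : Rn n → ℝ) (μ : VecRadon n) : Prop :=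
  ∀ φ : Rn n → Rn n, IsTestField φ → ∫ x, f x * fracDiv α φ x = -μ.pairing φ

/-- `ν` is the non-local fractional `α`-gradient measure `D^α_NL(f, g)` of the pair `(f, g)`. -/
def IsNLGradient {n : ℕ} (α : ℝ) (f g : Rn n → ℝ) (ν : VecRadon n) : Prop :=
  ∀ φ : Rn n → Rn n, IsTestField φ → ∫ x, f x * fracDivNL α g φ x = ν.pairing φ

/-- The precise representative `u^⋆` exists at `x` and equals `l`: the averages of `u` over the
balls `B_r(x)` tend to the real number `l` as `r → 0⁺`. -/
def HasPreciseValue {n : ℕ} (u : Rn n → ℝ) (x : Rn n) (l : ℝ) : Prop :=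
  Tendsto (fun r : ℝ => ⨍ y in Metric.ball x r, u y) (𝓝[>] 0) (𝓝 l)

end FracBV

end

/-! Write `g_k = ρ_k * g`. Splitting the increments of a product gives, pointwise, `div^α(g_k φ) =
g_k div^α φ + φ · ∇^α g_k + div^α_NL(g_k, φ)`. Integrate against `f`. Since `ρ_k` is even, `∫ f φ ·
∇^α g_k = -∫ g div^α(ρ_k * (f φ))`. Both `g_k φ` and `ρ_k * (f φ)` are test fields although `f` and
`g` are only bounded, so the first can be paired with `D^α f` and the second with `D^α g`
(`integral_mul_fracDiv_smoothing_smul`).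

Now let `k → ∞`. The Lebesgue integrals converge by dominated convergence. Since `ρ_k * (f φ) - (ρ_k
* f) φ` tends to zero uniformly, what remains is `ρ_k * f` against `D^α g` and `ρ_k * g` against
`D^α f`. These measures may be singular, so a.e. convergence is of no use; the traces `fbar`, `gbar`
are weak-star limits in `L^∞` (`exists_weakStar_limit`). Such limits keep the sup bound and agree
with the pointwise limit wherever it exists. The profile of `ρ_k` is close in `L¹` to the normalized
indicator of a ball, so this happens at every point with a precise value.

The resulting identity `exists_weak_leibniz` assumes nothing about `f g`. It shows that `φ ↦ ∫ f g
div^α φ` and `φ ↦ ∫ f div^α_NL(g, φ)` add up to a functional given by Radon measures, so one is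
locally bounded exactly when the other is. `exists_vecRadon_of_locallyBounded` turns bounded
functionals into measures, and `val_eq_of_forall_pairing_eq` turns tested identities into identities
on Borel sets. -/

noncomputable section

namespace FracBV

/-! ### Mollification, and its comparison with averages over balls. -/

section

open scoped Convolution
open ContinuousLinearMap Metric

variable {n : ℕ} {V : Type*} [NormedAddCommGroup V] [NormedSpace ℝ V]

/-- A bump function at the origin supported in the ball of radius `1 / (k + 1)` and equal to `1`
on a ball of almost the same radius. -/
def bump (n k : ℕ) : ContDiffBump (0 : Rn n) where
  -- The ratio `rIn / rOut = (k + 1) / (k + 2)` tends to 1; this is what makes `ρ_k` asymptotic in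
  -- `L¹` to the normalized indicator of its ball.
  rIn := 1 / (k + 1 : ℝ) * ((k + 1 : ℝ) / (k + 2))
  rOut := 1 / (k + 1 : ℝ)
  rIn_pos := by positivity
  rIn_lt_rOut := by
    have : (k + 1 : ℝ) / (k + 2) < 1 := by rw [div_lt_one (by positivity)]; linarith
    exact mul_lt_of_lt_one_right (by positivity) this

/-- The even mollifier associated with `bump n k`. -/
def rho (n k : ℕ) : Rn n → ℝ := (bump n k).normed volume

/-- The mollification `ρ_k * u`. -/
def smoothing (k : ℕ) (u : Rn n → V) : Rn n → V := rho n k ⋆[lsmul ℝ ℝ, volume] u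

lemma rho_nonneg (k : ℕ) (x : Rn n) : 0 ≤ rho n k x := (bump n k).nonneg_normed x

lemma contDiff_rho (k : ℕ) : ContDiff ℝ ∞ (rho n k) := (bump n k).contDiff_normed

lemma continuous_rho (k : ℕ) : Continuous (rho n k) := (bump n k).continuous_normed

lemma hasCompactSupport_rho (k : ℕ) : HasCompactSupport (rho n k) :=
  (bump n k).hasCompactSupport_normed

lemma integrable_rho (k : ℕ) : Integrable (rho n k) := (bump n k).integrable_normed

lemma integral_rho (k : ℕ) : ∫ x, rho n k x = 1 := (bump n k).integral_normed

lemma rho_neg (k : ℕ) (x : Rn n) : rho n k (-x) = rho n k x := (bump n k).normed_neg x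

lemma rho_eq_zero (k : ℕ) {x : Rn n} (hx : (bump n k).rOut ≤ ‖x‖) : rho n k x = 0 := by
  have := (bump n k).support_normed_eq (μ := volume)
  by_contra h
  have h' : x ∈ Function.support (rho n k) := h
  rw [rho, this] at h'
  simp at h'; linarith

lemma tendsto_bump_rOut (n : ℕ) : Tendsto (fun k => (bump n k).rOut) atTop (𝓝 0) :=
  tendsto_one_div_add_atTop_nhds_zero_nat

lemma bump_rOut_le_one (k : ℕ) : (bump n k).rOut ≤ 1 := by
  change 1 / (k + 1 : ℝ) ≤ 1
  rw [div_le_one (by positivity)]; linarith [(Nat.cast_nonneg k : (0 : ℝ) ≤ k)]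

lemma smoothing_apply (k : ℕ) (u : Rn n → V) (x : Rn n) :
    smoothing k u x = ∫ y, rho n k (x - y) • u y := by
  simp [smoothing, convolution_eq_swap]

lemma smoothing_apply' (k : ℕ) (u : Rn n → V) (x : Rn n) :
    smoothing k u x = ∫ y, rho n k y • u (x - y) := by
  simp [smoothing, convolution_def]

lemma integrable_smoothing_integrand (k : ℕ) {u : Rn n → V} (hu : LocallyIntegrable u)
    (x : Rn n) : Integrable fun y => rho n k (x - y) • u y := by
  have := (hasCompactSupport_rho (n := n) k).convolutionExists_left (lsmul ℝ ℝ)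
    (continuous_rho k) hu x
  have := this.integrable_swap
  simpa using this

lemma norm_smoothing_le (k : ℕ) {u : Rn n → V} {M : ℝ} (hM : ∀ x, ‖u x‖ ≤ M) (x : Rn n) :
    ‖smoothing k u x‖ ≤ M := by
  rw [smoothing_apply']
  refine (norm_integral_le_of_norm_le ((integrable_rho k).mul_const M)
    (ae_of_all _ fun y => ?_)).trans ?_
  · rw [norm_smul, Real.norm_of_nonneg (rho_nonneg k y)]
    exact mul_le_mul_of_nonneg_left (hM _) (rho_nonneg k y)
  · rw [integral_mul_const, integral_rho, one_mul]

lemma contDiff_smoothing [CompleteSpace V] (k : ℕ) {u : Rn n → V} (hu : LocallyIntegrable u) :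
    ContDiff ℝ ∞ (smoothing k u) :=
  (hasCompactSupport_rho k).contDiff_convolution_left _ (contDiff_rho k) hu

lemma hasCompactSupport_smoothing (k : ℕ) {u : Rn n → V} (hu : HasCompactSupport u) :
    HasCompactSupport (smoothing k u) :=
  (hasCompactSupport_rho k).convolution _ hu

lemma smoothing_eq_zero (k : ℕ) {u : Rn n → V} {R : ℝ} (hu : ∀ x, R ≤ ‖x‖ → u x = 0)
    {x : Rn n} (hx : R + 1 ≤ ‖x‖) : smoothing k u x = 0 := by
  rw [smoothing_apply']
  refine integral_eq_zero_of_ae (ae_of_all _ fun y => ?_)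
  rcases le_or_gt (bump n k).rOut ‖y‖ with h | h
  · simp [rho_eq_zero k h]
  · have := bump_rOut_le_one (n := n) k
    have h2 : ‖x‖ ≤ ‖x - y‖ + ‖y‖ := by simpa using norm_add_le (x - y) y
    simp [hu (x - y) (by linarith)]

lemma smoothing_add (k : ℕ) {u v : Rn n → V} (hu : LocallyIntegrable u)
    (hv : LocallyIntegrable v) :
    smoothing k (fun x => u x + v x) = fun x => smoothing k u x + smoothing k v x := by
  ext x
  simp only [smoothing_apply, smul_add]
  exact integral_add (integrable_smoothing_integrand k hu x) (integrable_smoothing_integrand k hv x)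

lemma smoothing_const_smul (k : ℕ) (c : ℝ) (u : Rn n → V) :
    smoothing k (fun x => c • u x) = fun x => c • smoothing k u x := by
  ext x
  simp only [smoothing_apply, smul_comm _ c]
  exact integral_smul _ _

/-- Mollification almost commutes with multiplication by a function of small oscillation. -/
lemma norm_smoothing_smul_sub_le (k : ℕ) {u : Rn n → ℝ} {φ : Rn n → V} {M ε : ℝ} [CompleteSpace V]
    (hu : LocallyIntegrable u) (huφ : LocallyIntegrable fun x => u x • φ x)
    (hM : ∀ x, |u x| ≤ M) {x : Rn n} (hφ : ∀ y, ‖x - y‖ < (bump n k).rOut → ‖φ y - φ x‖ ≤ ε) :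
    ‖smoothing k (fun x => u x • φ x) x - smoothing k u x • φ x‖ ≤ M * ε := by
  have hM0 : 0 ≤ M := (abs_nonneg _).trans (hM 0)
  have h1 := integrable_smoothing_integrand k huφ x
  have h2 := (integrable_smoothing_integrand k hu x).smul_const (φ x)
  rw [smoothing_apply, smoothing_apply, ← integral_smul_const, ← integral_sub h1 h2]
  have hi : ∫ y, rho n k (x - y) * (M * ε) = M * ε := by
    rw [integral_mul_const, integral_sub_left_eq_self (rho n k), integral_rho, one_mul]
  rw [← hi]
  refine norm_integral_le_of_norm_le
    (((integrable_rho k).comp_sub_left x).mul_const _) (ae_of_all _ fun y => ?_)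
  rcases le_or_gt (bump n k).rOut ‖x - y‖ with h | h
  · simp [rho_eq_zero k h]
  · have : rho n k (x - y) • u y • φ y - (rho n k (x - y) • u y) • φ x
        = rho n k (x - y) • u y • (φ y - φ x) := by
      rw [smul_assoc, smul_sub, smul_sub]
    rw [this, norm_smul, norm_smul, Real.norm_of_nonneg (rho_nonneg k _)]
    refine mul_le_mul_of_nonneg_left ?_ (rho_nonneg k _)
    exact mul_le_mul (hM y) (hφ y h) (norm_nonneg _) hM0

lemma norm_smoothing_sub_le (k : ℕ) {φ : Rn n → V} {ε : ℝ} [CompleteSpace V]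
    (hφ : LocallyIntegrable φ) {x : Rn n}
    (hε : ∀ y, ‖x - y‖ < (bump n k).rOut → ‖φ y - φ x‖ ≤ ε) :
    ‖smoothing k φ x - φ x‖ ≤ ε := by
  have h := norm_smoothing_smul_sub_le k (u := fun _ => 1) (φ := φ) (M := 1)
    (locallyIntegrable_const _) (by simpa using hφ) (by simp) hε
  have h1 : smoothing k (fun _ : Rn n => (1 : ℝ)) x = 1 := by
    rw [smoothing_apply]
    simp [integral_sub_left_eq_self (rho n k), integral_rho]
  simpa [h1] using h

lemma ae_tendsto_smoothing {u : Rn n → ℝ} (hu : LocallyIntegrable u) :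
    ∀ᵐ x, Tendsto (fun k => smoothing k u x) atTop (𝓝 (u x)) := by
  -- `K = 2` works because `rIn / rOut ≥ 1 / 2`, with equality at `k = 0`.
  refine ContDiffBump.ae_convolution_tendsto_right_of_locallyIntegrable (K := 2)
    (tendsto_bump_rOut n) (Eventually.of_forall fun k => ?_) hu
  change 1 / (k + 1 : ℝ) ≤ 2 * (1 / (k + 1 : ℝ) * ((k + 1 : ℝ) / (k + 2)))
  have : (1 : ℝ) ≤ 2 * ((k + 1 : ℝ) / (k + 2)) := by
    rw [← mul_div_assoc, le_div_iff₀ (by positivity)]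
    linarith [(Nat.cast_nonneg k : (0 : ℝ) ≤ k)]
  calc 1 / (k + 1 : ℝ) = 1 / (k + 1 : ℝ) * 1 := by ring
    _ ≤ 1 / (k + 1 : ℝ) * (2 * ((k + 1 : ℝ) / (k + 2))) := by gcongr
    _ = _ := by ring

/-- The `L¹` distance of `ρ_k` from the normalized indicator of its supporting ball. -/
lemma abs_smoothing_sub_average_le (k : ℕ) {u : Rn n → ℝ} {M : ℝ} (hu : LocallyIntegrable u)
    (hM : ∀ x, |u x| ≤ M) (x : Rn n) :
    |smoothing k u x - ⨍ y in ball x (bump n k).rOut, u y|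
      ≤ 2 * M * (1 - ((k + 1 : ℝ) / (k + 2)) ^ n) := by
  have hM0 : 0 ≤ M := (abs_nonneg _).trans (hM 0)
  set r := (bump n k).rOut with hr
  have hr0 : 0 < r := (bump n k).rOut_pos
  set q := ((k + 1 : ℝ) / (k + 2)) with hq
  have hq0 : 0 ≤ q := by positivity
  set I := ∫ y, bump n k y with hI
  have hI0 : 0 < I := (bump n k).integral_pos
  set B := volume.real (ball x r) with hB
  have hBc : volume.real (closedBall (0 : Rn n) r) = B := by
    rw [hB, measureReal_def, measureReal_def, Measure.addHaar_closedBall' _ _ hr0.le,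
      Measure.addHaar_ball_of_pos _ _ hr0, Measure.addHaar_unitClosedBall_eq_addHaar_unitBall]
  have hB0 : 0 < B := ENNReal.toReal_pos (measure_ball_pos _ _ hr0).ne' measure_ball_lt_top.ne
  have hIB : I ≤ B := hBc ▸ (bump n k).integral_le_measure_closedBall volume
  have hqB : q ^ n * B ≤ I := by
    refine le_trans (le_of_eq ?_) ((bump n k).measure_closedBall_le_integral volume)
    have h1 : (bump n k).rIn = r * q := rfl
    rw [h1, ← hBc, Measure.addHaar_real_closedBall' _ _ hr0.le,
      Measure.addHaar_real_closedBall' _ _ (mul_nonneg hr0.le hq0)]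
    simp only [finrank_euclideanSpace, Fintype.card_fin, mul_pow]; ring
  have hint : Integrable fun y => bump n k (x - y) := (bump n k).integrable.comp_sub_left x
  have hind : Integrable ((ball x r).indicator fun _ => (1 : ℝ)) :=
    (integrable_indicator_iff measurableSet_ball).2
      (integrableOn_const (by exact measure_ball_lt_top.ne))
  have hIy : ∫ y, bump n k (x - y) = I := integral_sub_left_eq_self (bump n k) _ x
  have hindI : ∫ y, (ball x r).indicator (fun _ => (1 : ℝ)) y = B := by
    rw [integral_indicator measurableSet_ball]; simp [hB]
  have hle : ∀ y, bump n k (x - y) ≤ (ball x r).indicator (fun _ => (1 : ℝ)) y := by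
    intro y
    by_cases hy : y ∈ ball x r
    · simp [hy, (bump n k).le_one]
    · rw [indicator_of_notMem hy]
      refine ((bump n k).zero_of_le_dist ?_).le
      simpa [dist_eq_norm, norm_sub_rev] using hy
  have e1 : smoothing k u x = I⁻¹ * ∫ y, bump n k (x - y) * u y := by
    rw [smoothing_apply, ← integral_const_mul]
    congr 1; ext y
    simp [rho, ContDiffBump.normed_def, hI]; ring
  have e2 : ⨍ y in ball x r, u y = B⁻¹ * ∫ y, (ball x r).indicator (fun _ => (1 : ℝ)) y * u y := by
    rw [setAverage_eq, smul_eq_mul, ← integral_indicator measurableSet_ball]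
    congr 2; ext y
    by_cases hy : y ∈ ball x r <;> simp [hy]
  have hiu1 : Integrable fun y => bump n k (x - y) * u y := by
    refine (hint.norm.mul_const M).mono' (hint.aestronglyMeasurable.mul hu.aestronglyMeasurable)
      (ae_of_all _ fun y => ?_)
    rw [norm_mul]; exact mul_le_mul_of_nonneg_left (hM y) (norm_nonneg _)
  have hiu2 : Integrable fun y => (ball x r).indicator (fun _ => (1 : ℝ)) y * u y := by
    refine (hind.norm.mul_const M).mono' (hind.aestronglyMeasurable.mul hu.aestronglyMeasurable)
      (ae_of_all _ fun y => ?_)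
    rw [norm_mul]; exact mul_le_mul_of_nonneg_left (hM y) (norm_nonneg _)
  have d1 : |(∫ y, (ball x r).indicator (fun _ => (1 : ℝ)) y * u y)
      - ∫ y, bump n k (x - y) * u y| ≤ M * (B - I) := by
    rw [← integral_sub hiu2 hiu1, ← Real.norm_eq_abs, ← hindI, ← hIy, ← integral_sub hind hint,
      ← integral_const_mul]
    refine norm_integral_le_of_norm_le ((hind.sub hint).const_mul M) (ae_of_all _ fun y => ?_)
    rw [← sub_mul, norm_mul, mul_comm, Real.norm_of_nonneg (sub_nonneg.2 (hle y))]
    exact mul_le_mul_of_nonneg_right (hM y) (sub_nonneg.2 (hle y))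
  have d2 : |∫ y, bump n k (x - y) * u y| ≤ M * I := by
    rw [← Real.norm_eq_abs, ← hIy, ← integral_const_mul]
    refine norm_integral_le_of_norm_le (hint.const_mul M) (ae_of_all _ fun y => ?_)
    rw [norm_mul, mul_comm, Real.norm_of_nonneg ((bump n k).nonneg' _)]
    exact mul_le_mul_of_nonneg_right (hM y) ((bump n k).nonneg' _)
  rw [e1, e2]
  set a := ∫ y, bump n k (x - y) * u y
  set b := ∫ y, (ball x r).indicator (fun _ => (1 : ℝ)) y * u y
  -- The error splits into a change of normalization and a change of integrand; each is at most `M *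
  -- (B - I)`, and `B - I ≤ (1 - q ^ n) * B`.
  have : I⁻¹ * a - B⁻¹ * b = B⁻¹ * ((B - I) / I * a - (b - a)) := by
    field_simp; ring
  have hBI : 0 ≤ B - I := sub_nonneg.2 hIB
  rw [this, abs_mul, abs_of_pos (inv_pos.2 hB0), inv_mul_le_iff₀ hB0]
  calc |(B - I) / I * a - (b - a)| ≤ |(B - I) / I * a| + |b - a| := abs_sub _ _
    _ ≤ (B - I) / I * (M * I) + M * (B - I) := by
      rw [abs_mul, abs_of_nonneg (div_nonneg hBI hI0.le)]; gcongr
    _ = 2 * M * (B - I) := by field_simp; ring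
    _ ≤ 2 * M * (B - q ^ n * B) := by gcongr
    _ = _ := by ring

/-- Convergence is needed at each individual point with a precise value, not just Lebesgue-a.e.,
because the variation measures may charge Lebesgue null sets. -/
lemma tendsto_smoothing_of_hasPreciseValue {u : Rn n → ℝ} {M : ℝ} (hu : LocallyIntegrable u)
    (hM : ∀ x, |u x| ≤ M) {x : Rn n} {l : ℝ} (h : HasPreciseValue u x l) :
    Tendsto (fun k => smoothing k u x) atTop (𝓝 l) := by
  have h1 : Tendsto (fun k => ⨍ y in ball x (bump n k).rOut, u y) atTop (𝓝 l) :=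
    h.comp (tendsto_nhdsWithin_iff.2
      ⟨tendsto_bump_rOut n, Eventually.of_forall fun k => (bump n k).rOut_pos⟩)
  have h2 : Tendsto (fun k : ℕ => 2 * M * (1 - ((k + 1 : ℝ) / (k + 2)) ^ n)) atTop (𝓝 0) := by
    have h3 : Tendsto (fun k : ℕ => (k + 1 : ℝ) / (k + 2)) atTop (𝓝 1) := by
      have h4 := (tendsto_const_nhds (x := (1 : ℝ))).sub
        ((tendsto_one_div_add_atTop_nhds_zero_nat (𝕜 := ℝ)).comp (tendsto_add_atTop_nat 1))
      simp only [sub_zero] at h4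
      refine h4.congr fun k => ?_
      simp only [Function.comp, Nat.cast_add, Nat.cast_one]
      field_simp; ring
    have := ((tendsto_const_nhds (x := (1 : ℝ))).sub (h3.pow n)).const_mul (2 * M)
    simpa using this
  have h3 : Tendsto (fun k => smoothing k u x - ⨍ y in ball x (bump n k).rOut, u y) atTop (𝓝 0) :=
    squeeze_zero_norm (fun k => abs_smoothing_sub_average_le k hu hM x) h2
  simpa using h3.add h1

end

/-! ### The singular kernel, and absolute convergence of the fractional divergences. -/

section

open Metric

variable {n : ℕ} {V : Type*} [NormedAddCommGroup V] [NormedSpace ℝ V]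

/-- The vector kernel `h / |h| ^ (n + α + 1)`. -/
def ker (α : ℝ) (h : Rn n) : Rn n := (‖h‖ ^ ((n : ℝ) + α + 1))⁻¹ • h

lemma measurable_ker (α : ℝ) : Measurable (ker α : Rn n → Rn n) := by
  unfold ker; fun_prop

lemma ker_neg (α : ℝ) (h : Rn n) : ker α (-h) = -ker α h := by simp [ker]

lemma norm_ker {α : ℝ} (hα : 0 < α) (h : Rn n) : ‖ker α h‖ = ‖h‖ ^ (-((n : ℝ) + α)) := by
  rw [ker, norm_smul, norm_inv, Real.norm_of_nonneg (by positivity)]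
  rcases (norm_nonneg h).eq_or_lt with h0 | h0
  -- At the origin both sides vanish: `0 ^ s = 0` in Lean for every `s ≠ 0`, even negative.
  · rw [← h0, mul_zero, Real.zero_rpow]
    have : (0 : ℝ) ≤ n := Nat.cast_nonneg n
    linarith
  · rw [Real.rpow_add_one h0.ne', Real.rpow_neg h0.le]
    field_simp

/-- In polar coordinates the integrand is `r ^ (-α)` near the origin, integrable as `α < 1`, and `r
^ (-1 - α)` at infinity, integrable as `α > 0`. -/
lemma integrable_min_mul_norm_ker (hn : 1 ≤ n) {α : ℝ} (hα : α ∈ Ioo (0 : ℝ) 1) :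
    Integrable fun h : Rn n => min 1 ‖h‖ * ‖ker α h‖ := by
  have : NeZero n := ⟨by omega⟩
  have : Nontrivial (Rn n) := by
    rw [← Module.finrank_pos_iff (R := ℝ)]; simp; omega
  simp only [norm_ker hα.1]
  refine (integrable_fun_norm_addHaar volume (E := Rn n)
    (f := fun r : ℝ => min 1 r * r ^ (-((n : ℝ) + α)))).2 ?_
  have e : ∀ r : ℝ, 0 < r → ∀ s : ℝ, r ^ (n - 1) * (r ^ s * r ^ (-((n : ℝ) + α)))
      = r ^ (s - 1 - α) := by
    intro r hr s
    rw [← Real.rpow_natCast, ← Real.rpow_add hr, ← Real.rpow_add hr, Nat.cast_sub hn]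
    congr 1; push_cast; ring
  rw [← Ioc_union_Ioi_eq_Ioi zero_le_one]
  refine IntegrableOn.union ?_ ?_
  · have h1 : IntegrableOn (fun r : ℝ => r ^ (-α)) (Ioc 0 1) :=
      (intervalIntegrable_iff_integrableOn_Ioc_of_le zero_le_one).1
        (intervalIntegral.intervalIntegrable_rpow' (by linarith [hα.2]))
    refine h1.congr_fun (fun r hr => ?_) measurableSet_Ioc
    have := e r hr.1 1
    simp only [Real.rpow_one] at this
    simp only [finrank_euclideanSpace, Fintype.card_fin, smul_eq_mul, min_eq_right hr.2, this]
    congr 1; ring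
  · have h1 : IntegrableOn (fun r : ℝ => r ^ (-1 - α)) (Ioi 1) :=
      integrableOn_Ioi_rpow_of_lt (by linarith [hα.1]) one_pos
    refine h1.congr_fun (fun r hr => ?_) measurableSet_Ioi
    have := e r (zero_lt_one.trans hr) 0
    simp only [Real.rpow_zero] at this
    simp only [finrank_euclideanSpace, Fintype.card_fin, smul_eq_mul, min_eq_left (mem_Ioi.1 hr).le,
      this]
    congr 1; ring

/-- `L¹` modulus of continuity of a smooth function with compact support. -/
lemma exists_integral_norm_sub_le {φ : Rn n → V} (hφ : ContDiff ℝ ∞ φ)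
    (hc : HasCompactSupport φ) :
    ∃ C, ∀ h : Rn n, ∫ x, ‖φ (x + h) - φ x‖ ≤ C * min 1 ‖h‖ := by
  obtain ⟨K, hK⟩ := hφ.lipschitzWith_of_hasCompactSupport hc (by simp)
  obtain ⟨R, hR⟩ := hc.isCompact.isBounded.subset_closedBall 0
  have hi : Integrable φ := hφ.continuous.integrable_of_hasCompactSupport hc
  have hi' : ∀ h, Integrable fun x => φ (x + h) := fun h => hi.comp_add_right h
  -- For `‖h‖ ≥ 1` the triangle inequality suffices. For `‖h‖ < 1` the increment is at most `K *
  -- ‖h‖` and vanishes off the ball of radius `R + 1`.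
  refine ⟨max (2 * ∫ x, ‖φ x‖) (K * volume.real (closedBall (0 : Rn n) (R + 1))), fun h => ?_⟩
  rcases le_or_gt 1 ‖h‖ with h1 | h1
  · rw [min_eq_left h1, mul_one]
    refine le_trans ?_ (le_max_left _ _)
    calc ∫ x, ‖φ (x + h) - φ x‖ ≤ ∫ x, (‖φ (x + h)‖ + ‖φ x‖) :=
          integral_mono ((hi' h).sub hi).norm ((hi' h).norm.add hi.norm) fun x => norm_sub_le _ _
      _ = 2 * ∫ x, ‖φ x‖ := by
          rw [integral_add (hi' h).norm hi.norm,
            integral_add_right_eq_self (fun x => ‖φ x‖)]; ring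
  · rw [min_eq_right h1.le]
    refine le_trans ?_ (mul_le_mul_of_nonneg_right (le_max_right _ _) (norm_nonneg h))
    have hs : ∀ x, x ∉ closedBall (0 : Rn n) R → φ x = 0 := fun x hx =>
      image_eq_zero_of_notMem_tsupport fun h => hx (hR h)
    have hz : ∀ x, x ∉ closedBall (0 : Rn n) (R + 1) → ‖φ (x + h) - φ x‖ = 0 := by
      intro x hx
      simp only [mem_closedBall_zero_iff, not_le] at hx hs
      have : ‖x‖ ≤ ‖x + h‖ + ‖h‖ := by simpa using norm_sub_le (x + h) h
      rw [hs x (by linarith), hs (x + h) (by linarith)]; simp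
    rw [← setIntegral_eq_integral_of_forall_compl_eq_zero hz]
    calc ∫ x in closedBall 0 (R + 1), ‖φ (x + h) - φ x‖
        ≤ ∫ x in closedBall (0 : Rn n) (R + 1), K * ‖h‖ := by
          refine integral_mono ((hi' h).sub hi).norm.integrableOn
            (integrableOn_const (by exact measure_closedBall_lt_top.ne)) fun x => ?_
          simpa [dist_eq_norm] using hK.dist_le_mul (x + h) x
      _ = _ := by simp; ring

/-- Tonelli with the `x`-integral inside: the `L¹` modulus of continuity contributes the factor `min
1 ‖h‖` that tames the kernel. This joint integrability justifies the later exchanges of integrals.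
-/
lemma integrable_norm_ker_mul_norm_sub (hn : 1 ≤ n) {α : ℝ} (hα : α ∈ Ioo (0 : ℝ) 1)
    {φ : Rn n → V} (hφ : ContDiff ℝ ∞ φ) (hc : HasCompactSupport φ) :
    Integrable (fun p : Rn n × Rn n => ‖ker α p.2‖ * ‖φ (p.1 + p.2) - φ p.1‖)
      (volume.prod volume) := by
  obtain ⟨C, hC⟩ := exists_integral_norm_sub_le hφ hc
  have hcont := hφ.continuous
  have hi : Integrable φ := hcont.integrable_of_hasCompactSupport hc
  have hm : AEStronglyMeasurable
      (fun p : Rn n × Rn n => ‖ker α p.2‖ * ‖φ (p.1 + p.2) - φ p.1‖) (volume.prod volume) := by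
    refine ((measurable_ker α).comp measurable_snd).norm.aestronglyMeasurable.mul ?_
    exact (by fun_prop : Continuous fun p : Rn n × Rn n =>
      ‖φ (p.1 + p.2) - φ p.1‖).aestronglyMeasurable
  rw [integrable_prod_iff' hm]
  refine ⟨ae_of_all _ fun h => ((hi.comp_add_right h).sub hi).norm.const_mul ‖ker α h‖, ?_⟩
  refine ((integrable_min_mul_norm_ker hn hα).const_mul C).mono'
    hm.norm.prod_swap.integral_prod_right' (ae_of_all _ fun h => ?_)
  rw [Real.norm_of_nonneg (integral_nonneg fun _ => norm_nonneg _)]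
  simp only [norm_mul, norm_norm]
  rw [integral_const_mul]
  calc ‖ker α h‖ * ∫ x, ‖φ (x + h) - φ x‖ ≤ ‖ker α h‖ * (C * min 1 ‖h‖) := by gcongr; exact hC h
    _ = _ := by ring

/-- Fubini would give this for a.e. `x` only; the pointwise Leibniz identity uses every `x`, so the
increment is bounded directly by the sup and Lipschitz bounds. -/
lemma integrable_norm_ker_mul_norm_sub_section (hn : 1 ≤ n) {α : ℝ} (hα : α ∈ Ioo (0 : ℝ) 1)
    {φ : Rn n → V} (hφ : ContDiff ℝ ∞ φ) (hc : HasCompactSupport φ) (x : Rn n) :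
    Integrable fun h : Rn n => ‖ker α h‖ * ‖φ (x + h) - φ x‖ := by
  obtain ⟨K, hK⟩ := hφ.lipschitzWith_of_hasCompactSupport hc (by simp)
  obtain ⟨M, hM⟩ := hc.exists_bound_of_continuous hφ.continuous
  have hcont := hφ.continuous
  refine ((integrable_min_mul_norm_ker hn hα).const_mul (max (2 * M) K)).mono' ?_
    (ae_of_all _ fun h => ?_)
  · refine (measurable_ker α).norm.aestronglyMeasurable.mul ?_
    exact (by fun_prop : Continuous fun h : Rn n => ‖φ (x + h) - φ x‖).aestronglyMeasurable
  · rw [norm_mul, norm_norm, norm_norm]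
    have h1 : ‖φ (x + h) - φ x‖ ≤ max (2 * M) K * min 1 ‖h‖ := by
      rcases le_or_gt 1 ‖h‖ with h1 | h1
      · rw [min_eq_left h1, mul_one]
        refine le_trans ?_ (le_max_left _ _)
        linarith [norm_sub_le (φ (x + h)) (φ x), hM (x + h), hM x]
      · rw [min_eq_right h1.le]
        refine le_trans ?_ (mul_le_mul_of_nonneg_right (le_max_right _ _) (norm_nonneg h))
        simpa [dist_eq_norm] using hK.dist_le_mul (x + h) x
    calc ‖ker α h‖ * ‖φ (x + h) - φ x‖ ≤ ‖ker α h‖ * (max (2 * M) K * min 1 ‖h‖) := by gcongr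
      _ = _ := by ring

/-- The substitution `y = x + h` frees the kernel from `x`, which suits Fubini and translation
invariance. -/
lemma fracDiv_eq (α : ℝ) (φ : Rn n → Rn n) (x : Rn n) :
    fracDiv α φ x = muConst n α * ∫ h, ⟪φ (x + h) - φ x, ker α h⟫ := by
  rw [fracDiv, ← integral_add_left_eq_self _ x]
  simp only [add_sub_cancel_left, ker, real_inner_smul_right, div_eq_inv_mul]

lemma fracDivNL_eq (α : ℝ) (g : Rn n → ℝ) (φ : Rn n → Rn n) (x : Rn n) :
    fracDivNL α g φ x
      = muConst n α * ∫ h, (g (x + h) - g x) * ⟪φ (x + h) - φ x, ker α h⟫ := by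
  rw [fracDivNL, ← integral_add_left_eq_self _ x]
  simp only [add_sub_cancel_left, ker, real_inner_smul_right]
  congr 2; ext h; ring

lemma integrable_inner_ker (hn : 1 ≤ n) {α : ℝ} (hα : α ∈ Ioo (0 : ℝ) 1)
    {φ : Rn n → Rn n} (hφ : IsTestField φ) :
    Integrable (fun p : Rn n × Rn n => ⟪φ (p.1 + p.2) - φ p.1, ker α p.2⟫)
      (volume.prod volume) := by
  refine (integrable_norm_ker_mul_norm_sub hn hα hφ.1 hφ.2).mono' ?_ (ae_of_all _ fun p => ?_)
  · have := hφ.1.continuous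
    exact ((by fun_prop : Continuous fun p : Rn n × Rn n =>
      φ (p.1 + p.2) - φ p.1).measurable.inner
        ((measurable_ker α).comp measurable_snd)).aestronglyMeasurable
  · rw [mul_comm]; exact norm_inner_le_norm _ _

lemma integrable_inner_ker_section (hn : 1 ≤ n) {α : ℝ} (hα : α ∈ Ioo (0 : ℝ) 1)
    {φ : Rn n → Rn n} (hφ : IsTestField φ) (x : Rn n) :
    Integrable fun h : Rn n => ⟪φ (x + h) - φ x, ker α h⟫ := by
  refine (integrable_norm_ker_mul_norm_sub_section hn hα hφ.1 hφ.2 x).mono' ?_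
    (ae_of_all _ fun p => ?_)
  · have := hφ.1.continuous
    exact ((by fun_prop : Continuous fun h : Rn n =>
      φ (x + h) - φ x).measurable.inner (measurable_ker α)).aestronglyMeasurable
  · rw [mul_comm]; exact norm_inner_le_norm _ _

lemma integrable_fracDiv (hn : 1 ≤ n) {α : ℝ} (hα : α ∈ Ioo (0 : ℝ) 1)
    {φ : Rn n → Rn n} (hφ : IsTestField φ) : Integrable (fracDiv α φ) := by
  have := ((integrable_inner_ker hn hα hφ).integral_prod_left).const_mul (muConst n α)
  exact this.congr (ae_of_all _ fun x => (fracDiv_eq α φ x).symm)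

lemma fracDiv_add (hn : 1 ≤ n) {α : ℝ} (hα : α ∈ Ioo (0 : ℝ) 1)
    {φ ψ : Rn n → Rn n} (hφ : IsTestField φ) (hψ : IsTestField ψ) (x : Rn n) :
    fracDiv α (fun x => φ x + ψ x) x = fracDiv α φ x + fracDiv α ψ x := by
  simp only [fracDiv_eq, ← mul_add]
  rw [← integral_add (integrable_inner_ker_section hn hα hφ x)
    (integrable_inner_ker_section hn hα hψ x)]
  congr 2; ext h
  rw [← inner_add_left]; congr 1; abel

lemma fracDiv_const_smul {α : ℝ} (c : ℝ) (φ : Rn n → Rn n) (x : Rn n) :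
    fracDiv α (fun x => c • φ x) x = c * fracDiv α φ x := by
  simp only [fracDiv_eq, ← smul_sub, real_inner_smul_left, integral_const_mul]
  ring

/-- `f` is a Borel function bounded by `M`. -/
structure IsBddBorel (f : Rn n → ℝ) (M : ℝ) : Prop where
  measurable : Measurable f
  le : ∀ x, |f x| ≤ M

lemma IsBddBorel.nonneg {f : Rn n → ℝ} {M : ℝ} (hf : IsBddBorel f M) : 0 ≤ M :=
  (abs_nonneg _).trans (hf.le 0)

lemma IsBddBorel.mul {f g : Rn n → ℝ} {M N : ℝ} (hf : IsBddBorel f M) (hg : IsBddBorel g N) :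
    IsBddBorel (fun x => f x * g x) (M * N) :=
  ⟨hf.1.mul hg.1, fun x => by
    rw [abs_mul]; exact mul_le_mul (hf.2 x) (hg.2 x) (abs_nonneg _) hf.nonneg⟩

lemma IsBddBorel.integrable_mul {f u : Rn n → ℝ} {M : ℝ} {ν : Measure (Rn n)}
    (hf : IsBddBorel f M) (hu : Integrable u ν) : Integrable (fun x => f x * u x) ν :=
  hu.bdd_mul (c := M) hf.1.aestronglyMeasurable (ae_of_all _ hf.2)

lemma IsBddBorel.integrable_smul {f : Rn n → ℝ} {u : Rn n → V} {M : ℝ} {ν : Measure (Rn n)}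
    (hf : IsBddBorel f M) (hu : Integrable u ν) : Integrable (fun x => f x • u x) ν :=
  hu.bdd_smul M hf.1.aestronglyMeasurable (ae_of_all _ hf.2)

lemma IsBddBorel.locallyIntegrable {f : Rn n → ℝ} {M : ℝ} {ν : Measure (Rn n)}
    [IsLocallyFiniteMeasure ν] (hf : IsBddBorel f M) : LocallyIntegrable f ν :=
  (locallyIntegrable_const M).mono hf.1.aestronglyMeasurable
    (ae_of_all _ fun x => (hf.2 x).trans (le_abs_self M))

lemma IsBddBorel.sub_norm_le {g : Rn n → ℝ} {M : ℝ} (hg : IsBddBorel g M) (x y : Rn n) :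
    ‖g x - g y‖ ≤ 2 * M := by
  have := norm_sub_le (g x) (g y)
  have h1 := hg.2 x
  have h2 := hg.2 y
  simp only [Real.norm_eq_abs] at *
  linarith

lemma integrable_nl (hn : 1 ≤ n) {α : ℝ} (hα : α ∈ Ioo (0 : ℝ) 1) {f g : Rn n → ℝ} {M N : ℝ}
    (hf : IsBddBorel f M) (hg : IsBddBorel g N) {φ : Rn n → Rn n} (hφ : IsTestField φ) :
    Integrable (fun p : Rn n × Rn n =>
      f p.1 * ((g (p.1 + p.2) - g p.1) * ⟪φ (p.1 + p.2) - φ p.1, ker α p.2⟫))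
      (volume.prod volume) := by
  have hm := hg.1
  have h1 := (integrable_inner_ker hn hα hφ).bdd_mul (c := 2 * N)
    (f := fun p : Rn n × Rn n => g (p.1 + p.2) - g p.1)
    (by fun_prop : Measurable fun p : Rn n × Rn n => g (p.1 + p.2) - g p.1).aestronglyMeasurable
    (ae_of_all _ fun p => hg.sub_norm_le _ _)
  exact h1.bdd_mul (c := M) (f := fun p : Rn n × Rn n => f p.1)
    (hf.1.comp measurable_fst).aestronglyMeasurable (ae_of_all _ fun p => hf.2 _)

/-- As a single integral over the product space, the non-local term can be passed to the limit by
one application of dominated convergence. -/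
lemma integral_mul_fracDivNL (hn : 1 ≤ n) {α : ℝ} (hα : α ∈ Ioo (0 : ℝ) 1) {f g : Rn n → ℝ}
    {M N : ℝ} (hf : IsBddBorel f M) (hg : IsBddBorel g N) {φ : Rn n → Rn n}
    (hφ : IsTestField φ) :
    Integrable (fun x => f x * fracDivNL α g φ x) ∧
    ∫ x, f x * fracDivNL α g φ x = muConst n α * ∫ p : Rn n × Rn n,
      f p.1 * ((g (p.1 + p.2) - g p.1) * ⟪φ (p.1 + p.2) - φ p.1, ker α p.2⟫)
      ∂(volume.prod volume) := by
  have hi := integrable_nl hn hα hf hg hφ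
  have e : ∀ x, f x * fracDivNL α g φ x = muConst n α *
      ∫ h, f x * ((g (x + h) - g x) * ⟪φ (x + h) - φ x, ker α h⟫) := fun x => by
    rw [fracDivNL_eq, integral_const_mul]; ring
  simp only [e]
  refine ⟨hi.integral_prod_left.const_mul _, ?_⟩
  rw [integral_prod _ hi, integral_const_mul]

end

/-! ### Fractional gradients of mollified functions, and the Leibniz rule with one mollified factor.
-/

section

open Metric

variable {n : ℕ} {V : Type*} [NormedAddCommGroup V] [NormedSpace ℝ V]

/-- The fractional gradient of a scalar function, without its normalization constant. -/
def grad (α : ℝ) (u : Rn n → ℝ) (x : Rn n) : Rn n := ∫ h, (u (x + h) - u x) • ker α h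

lemma integrable_smul_ker (hn : 1 ≤ n) {α : ℝ} (hα : α ∈ Ioo (0 : ℝ) 1)
    {u : Rn n → ℝ} (hu : ContDiff ℝ ∞ u) (hc : HasCompactSupport u) :
    Integrable (fun p : Rn n × Rn n => (u (p.1 + p.2) - u p.1) • ker α p.2)
      (volume.prod volume) := by
  refine (integrable_norm_ker_mul_norm_sub hn hα hu hc).mono' ?_ (ae_of_all _ fun p => ?_)
  · have := hu.continuous
    exact ((by fun_prop : Continuous fun p : Rn n × Rn n =>
      u (p.1 + p.2) - u p.1).measurable.smul
        ((measurable_ker α).comp measurable_snd)).aestronglyMeasurable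
  · rw [norm_smul, mul_comm]

lemma integrable_grad (hn : 1 ≤ n) {α : ℝ} (hα : α ∈ Ioo (0 : ℝ) 1)
    {u : Rn n → ℝ} (hu : ContDiff ℝ ∞ u) (hc : HasCompactSupport u) : Integrable (grad α u) :=
  (integrable_smul_ker hn hα hu hc).integral_prod_left

lemma measurePreserving_sub_prod (x : Rn n) :
    MeasurePreserving (fun p : Rn n × Rn n => (x - p.1, p.2)) (volume.prod volume)
      (volume.prod volume) :=
  (Measure.measurePreserving_sub_left volume x).prod (MeasurePreserving.id volume)

lemma measurePreserving_prod_sub (z : Rn n) :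
    MeasurePreserving (fun p : Rn n × Rn n => (p.1 - z, p.2)) (volume.prod volume)
      (volume.prod volume) :=
  (measurePreserving_sub_right volume z).prod (MeasurePreserving.id volume)

/-- The fractional gradient of a mollified function, as a convolution with `∇^α ρ_k`. -/
lemma grad_smoothing (hn : 1 ≤ n) {α : ℝ} (hα : α ∈ Ioo (0 : ℝ) 1) {g : Rn n → ℝ} {M : ℝ}
    (hg : IsBddBorel g M) (k : ℕ) (x : Rn n) :
    Integrable (fun h => (smoothing k g (x + h) - smoothing k g x) • ker α h) ∧
    grad α (smoothing k g) x = ∫ z, g z • grad α (rho n k) (x - z) := by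
  have h1 := (measurePreserving_sub_prod x).integrable_comp_of_integrable
    (integrable_smul_ker hn hα (contDiff_rho (n := n) k) (hasCompactSupport_rho k))
  have h2 : Integrable (fun p : Rn n × Rn n =>
      g p.1 • (rho n k (x - p.1 + p.2) - rho n k (x - p.1)) • ker α p.2)
      (volume.prod volume) :=
    h1.bdd_smul M (hg.1.comp measurable_fst).aestronglyMeasurable (ae_of_all _ fun p => hg.2 _)
  have e : ∀ h, (smoothing k g (x + h) - smoothing k g x) • ker α h
      = ∫ z, g z • (rho n k (x - z + h) - rho n k (x - z)) • ker α h := by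
    intro h
    rw [smoothing_apply, smoothing_apply, ← integral_sub
      (integrable_smoothing_integrand k hg.locallyIntegrable _)
      (integrable_smoothing_integrand k hg.locallyIntegrable _), ← integral_smul_const]
    congr 1; ext1 z
    rw [smul_smul, ← sub_smul, smul_eq_mul, show x + h - z = x - z + h by abel]
    congr 1; ring
  -- `ρ_k * g` need not have compact support, so integrability is inherited by Fubini from the
  -- double integral of `ρ_k` against the bounded `g`.
  refine ⟨by simpa only [e] using h2.integral_prod_right, ?_⟩
  simp only [grad, e, ← integral_smul]
  exact (integral_integral_swap h2).symm

/-- The fractional divergence of a mollified field, as a convolution with `∇^α ρ_k`. -/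
lemma integral_inner_grad_rho (hn : 1 ≤ n) {α : ℝ} (hα : α ∈ Ioo (0 : ℝ) 1) {F : Rn n → Rn n}
    {M : ℝ} (hF : Measurable F) (hM : ∀ x, ‖F x‖ ≤ M) (k : ℕ) (z : Rn n) :
    muConst n α * ∫ x, ⟪F x, grad α (rho n k) (x - z)⟫ = -fracDiv α (smoothing k F) z := by
  have hFl : LocallyIntegrable F := (locallyIntegrable_const M).mono hF.aestronglyMeasurable
    (ae_of_all _ fun x => (hM x).trans (le_abs_self M))
  have h1 := (measurePreserving_prod_sub z).integrable_comp_of_integrable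
    (integrable_smul_ker hn hα (contDiff_rho (n := n) k) (hasCompactSupport_rho k))
  have h2 : Integrable (fun p : Rn n × Rn n =>
      ⟪F p.1, (rho n k (p.1 - z + p.2) - rho n k (p.1 - z)) • ker α p.2⟫)
      (volume.prod volume) := by
    refine (h1.norm.const_mul M).mono' ?_ (ae_of_all _ fun p => ?_)
    · exact (hF.comp measurable_fst).aestronglyMeasurable.inner h1.aestronglyMeasurable
    · refine (norm_inner_le_norm _ _).trans ?_
      exact mul_le_mul_of_nonneg_right (hM _) (norm_nonneg _)
  have hs : ∀ᵐ x, Integrable fun h => (rho n k (x - z + h) - rho n k (x - z)) • ker α h :=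
    h1.prod_right_ae
  have e1 : ∫ x, ⟪F x, grad α (rho n k) (x - z)⟫
      = ∫ x, ∫ h, ⟪F x, (rho n k (x - z + h) - rho n k (x - z)) • ker α h⟫ := by
    refine integral_congr_ae (hs.mono fun x hx => ?_)
    simp only [grad]
    exact (integral_inner hx (F x)).symm
  have e2 : ∀ h, ∫ x, ⟪F x, (rho n k (x - z + h) - rho n k (x - z)) • ker α h⟫
      = ⟪smoothing k F (z - h) - smoothing k F z, ker α h⟫ := by
    intro h
    have i1 := integrable_smoothing_integrand k hFl (z - h)
    have i2 := integrable_smoothing_integrand k hFl z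
    have i3 : Integrable fun y => rho n k (z - h - y) • F y - rho n k (z - y) • F y := i1.sub i2
    rw [smoothing_apply, smoothing_apply, ← integral_sub i1 i2, real_inner_comm,
      ← integral_inner i3]
    congr 1; ext1 x
    -- Evenness of `ρ_k` reverses its arguments, so that the `x`-integral becomes a mollification of
    -- `F`.
    rw [real_inner_comm, ← sub_smul, real_inner_smul_left, real_inner_smul_right,
      ← rho_neg k (x - z + h), ← rho_neg k (x - z), show -(x - z + h) = z - h - x by abel,
      neg_sub]
  rw [e1, integral_integral_swap h2]
  simp only [e2]
  -- Replacing `h` by `-h` and using that the kernel is odd produces the minus sign of integration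
  -- by parts.
  rw [fracDiv_eq, ← integral_neg_eq_self]
  simp only [ker_neg, inner_neg_right, integral_neg, sub_neg_eq_add, mul_neg]

/-- Integration by parts between `∇^α` and `div^α` for mollified functions. -/
lemma integral_inner_grad_smoothing (hn : 1 ≤ n) {α : ℝ} (hα : α ∈ Ioo (0 : ℝ) 1)
    {F : Rn n → Rn n} {M N : ℝ} (hF : Measurable F) (hM : ∀ x, ‖F x‖ ≤ M) (hFi : Integrable F)
    {g : Rn n → ℝ} (hg : IsBddBorel g N) (k : ℕ) :
    muConst n α * ∫ x, ⟪F x, grad α (smoothing k g) x⟫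
      = -∫ z, g z * fracDiv α (smoothing k F) z := by
  have hG := integrable_grad hn hα (contDiff_rho (n := n) k) (hasCompactSupport_rho k)
  have h1 : Integrable (fun p : Rn n × Rn n => ⟪F p.2, grad α (rho n k) (p.2 - p.1)⟫)
      (volume.prod volume) := by
    -- This is the integrand of the convolution of `F` with the reflected `∇^α ρ_k`, two `L¹`
    -- functions.
    have := hFi.convolution_integrand (innerSL ℝ) hG.comp_neg
    simp only [neg_sub] at this
    exact this
  have h2 : Integrable (fun p : Rn n × Rn n => g p.1 * ⟪F p.2, grad α (rho n k) (p.2 - p.1)⟫)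
      (volume.prod volume) :=
    h1.bdd_mul (c := N) (hg.1.comp measurable_fst).aestronglyMeasurable
      (ae_of_all _ fun p => hg.2 _)
  have e1 : ∀ x, ⟪F x, grad α (smoothing k g) x⟫
      = ∫ z, g z * ⟪F x, grad α (rho n k) (x - z)⟫ := by
    intro x
    rw [(grad_smoothing hn hα hg k x).2,
      ← integral_inner (hg.integrable_smul (hG.comp_sub_left x))]
    simp only [real_inner_smul_right]
  simp only [e1]
  rw [← integral_integral_swap h2, ← integral_const_mul, ← integral_neg]
  congr 1; ext z
  rw [integral_const_mul, mul_left_comm, integral_inner_grad_rho hn hα hF hM, mul_neg]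

lemma isBddBorel_smoothing {g : Rn n → ℝ} {M : ℝ} (hg : IsBddBorel g M) (k : ℕ) :
    IsBddBorel (smoothing k g) M :=
  ⟨(contDiff_smoothing k hg.locallyIntegrable).continuous.measurable,
    norm_smoothing_le (V := ℝ) k (u := g) hg.2⟩

lemma IsTestField.smul {φ : Rn n → Rn n} (hφ : IsTestField φ) {u : Rn n → ℝ}
    (hu : ContDiff ℝ ∞ u) : IsTestField fun x => u x • φ x where
  contDiff := ContDiff.smul hu hφ.1
  hasCompactSupport := HasCompactSupport.smul_left (f := u) hφ.2

/-- Leibniz rule with one mollified factor. -/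
lemma integral_mul_fracDiv_smoothing_smul (hn : 1 ≤ n) {α : ℝ} (hα : α ∈ Ioo (0 : ℝ) 1)
    {f g : Rn n → ℝ} {M N : ℝ} (hf : IsBddBorel f M) (hg : IsBddBorel g N)
    {φ : Rn n → Rn n} (hφ : IsTestField φ) (k : ℕ) :
    ∫ x, f x * fracDiv α (fun x => smoothing k g x • φ x) x
      = (∫ x, f x * smoothing k g x * fracDiv α φ x)
        - (∫ x, g x * fracDiv α (smoothing k fun x => f x • φ x) x)
        + ∫ x, f x * fracDivNL α (smoothing k g) φ x := by
  have hgk := isBddBorel_smoothing hg k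
  have hgφ := hφ.smul (contDiff_smoothing k hg.locallyIntegrable)
  -- From `a'b' - ab = a(b' - b) + (a' - a)b + (a' - a)(b' - b)`, each of the three terms being
  -- integrable against the kernel.
  have hpt : ∀ x, fracDiv α (fun x => smoothing k g x • φ x) x
      = smoothing k g x * fracDiv α φ x + muConst n α * ⟪φ x, grad α (smoothing k g) x⟫
        + fracDivNL α (smoothing k g) φ x := by
    intro x
    have i1 := (integrable_inner_ker_section hn hα hφ x).const_mul (smoothing k g x)
    have i2 := (grad_smoothing hn hα hg k x).1.const_inner (𝕜 := ℝ) (φ x)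
    have i12 : Integrable fun h => smoothing k g x * ⟪φ (x + h) - φ x, ker α h⟫
        + ⟪φ x, (smoothing k g (x + h) - smoothing k g x) • ker α h⟫ := i1.add i2
    have i3 : Integrable fun h => (smoothing k g (x + h) - smoothing k g x) *
        ⟪φ (x + h) - φ x, ker α h⟫ := by
      refine (integrable_inner_ker_section hn hα hφ x).bdd_mul (c := 2 * N)
        (f := fun h => smoothing k g (x + h) - smoothing k g x) ?_
        (ae_of_all _ fun p => hgk.sub_norm_le _ _)
      have := hgk.1
      exact (by fun_prop : Measurable fun h =>
        smoothing k g (x + h) - smoothing k g x).aestronglyMeasurable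
    rw [fracDiv_eq, fracDiv_eq, fracDivNL_eq, grad,
      ← integral_inner (grad_smoothing hn hα hg k x).1, mul_left_comm,
      ← integral_const_mul (smoothing k g x),
      ← mul_add, ← integral_add i1 i2, ← mul_add, ← integral_add i12 i3]
    congr 2; ext h
    simp only [inner_sub_left, real_inner_smul_left, real_inner_smul_right]
    ring
  have i1 : Integrable fun x => f x * smoothing k g x * fracDiv α φ x :=
    (hf.mul hgk).integrable_mul (integrable_fracDiv hn hα hφ)
  have i3 := (integral_mul_fracDivNL hn hα hf hgk hφ).1
  have i0 := hf.integrable_mul (integrable_fracDiv hn hα hgφ)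
  -- The gradient term is integrable because, by `hpt`, it is a difference of terms already known to
  -- be integrable.
  have i2 : Integrable fun x => muConst n α * ⟪f x • φ x, grad α (smoothing k g) x⟫ := by
    refine ((i0.sub i1).sub i3).congr (ae_of_all _ fun x => ?_)
    simp only [Pi.sub_apply, hpt, real_inner_smul_left]; ring
  have i12 : Integrable fun x => f x * smoothing k g x * fracDiv α φ x
      + muConst n α * ⟪f x • φ x, grad α (smoothing k g) x⟫ := i1.add i2
  obtain ⟨C, hC⟩ := hφ.2.exists_bound_of_continuous hφ.1.continuous
  -- The field `f φ` is only bounded, integrable and Borel; integration by parts moves the mollifier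
  -- onto it and leaves `g` bare.
  have hF := integral_inner_grad_smoothing hn hα (F := fun x => f x • φ x) (M := M * C)
    (hf.1.smul hφ.1.continuous.measurable)
    (fun x => by
      rw [norm_smul]; exact mul_le_mul (hf.2 x) (hC x) (norm_nonneg _) hf.nonneg)
    (hf.integrable_smul (hφ.1.continuous.integrable_of_hasCompactSupport hφ.2)) hg k
  rw [sub_eq_add_neg, ← hF, ← integral_const_mul, ← integral_add i1 i2,
    ← integral_add i12 i3]
  congr 1; ext x
  simp only [hpt, real_inner_smul_left]; ring

end

/-! ### Weak-star limits of bounded sequences along an ultrafilter. -/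

section

section WeakStar

variable {X : Type*} [MeasurableSpace X]

/-- Bounded sequences in `L²` of a finite measure converge weakly along a nonprincipal
ultrafilter. -/
lemma exists_weak_limit_memLp_two (μ : Measure X) [IsFiniteMeasure μ] {u : ℕ → X → ℝ} {M : ℝ}
    (hM0 : 0 ≤ M) (hm : ∀ k, Measurable (u k)) (hM : ∀ k x, |u k x| ≤ M) :
    ∃ v : X → ℝ, MemLp v 2 μ ∧ ∀ w, MemLp w 2 μ →
      Tendsto (fun k => ∫ x, u k x * w x ∂μ) (hyperfilter ℕ) (𝓝 (∫ x, v x * w x ∂μ)) := by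
  have hu : ∀ k, MemLp (u k) 2 μ := fun k =>
    MemLp.of_bound (hm k).aestronglyMeasurable M (ae_of_all _ (hM k))
  let U : ℕ → Lp ℝ 2 μ := fun k => (hu k).toLp (u k)
  obtain ⟨C, hC⟩ : ∃ C, ∀ k, ‖U k‖ ≤ C := by
    refine ⟨_, fun k => Lp.norm_le_of_ae_bound (C := M) hM0 ?_⟩
    · filter_upwards [(hu k).coeFn_toLp] with x hx
      rw [hx]; exact hM k x
  let T : ℕ → WeakDual ℝ (Lp ℝ 2 μ) := fun k =>
    StrongDual.toWeakDual (InnerProductSpace.toDual ℝ _ (U k))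
  have hT : ∀ k, T k ∈ WeakDual.toStrongDual ⁻¹'
      Metric.closedBall (0 : StrongDual ℝ (Lp ℝ 2 μ)) C := by
    intro k
    simpa [T] using hC k
  -- Banach–Alaoglu: along an ultrafilter compactness alone gives a limit, with no subsequence to
  -- extract.
  obtain ⟨ℓ, -, hℓ⟩ := (WeakDual.isCompact_closedBall (𝕜 := ℝ)
    (0 : StrongDual ℝ (Lp ℝ 2 μ)) C).ultrafilter_le_nhds
    ((hyperfilter ℕ : Ultrafilter ℕ).map T) (by
      rw [le_principal_iff]; exact Filter.mem_map.2 (Eventually.of_forall hT))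
  let v : Lp ℝ 2 μ := (InnerProductSpace.toDual ℝ _).symm (WeakDual.toStrongDual ℓ)
  refine ⟨v, Lp.memLp v, fun w hw => ?_⟩
  have h1 : Tendsto (fun k => T k (hw.toLp w)) (hyperfilter ℕ) (𝓝 (ℓ (hw.toLp w))) :=
    ((WeakDual.eval_continuous (hw.toLp w)).tendsto ℓ).comp hℓ
  have h2 : ∀ z : Lp ℝ 2 μ, ⟪z, hw.toLp w⟫ = ∫ x, z x * w x ∂μ := by
    intro z
    rw [L2.inner_def]
    refine integral_congr_ae (hw.coeFn_toLp.mono fun x hx => ?_)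
    simp [hx, mul_comm]
  have h3 : ℓ (hw.toLp w) = ∫ x, v x * w x ∂μ := by
    rw [← h2]
    exact (InnerProductSpace.toDual_symm_apply (𝕜 := ℝ)).symm
  rw [← h3]
  refine h1.congr fun k => ?_
  have h4 : T k (hw.toLp w) = ⟪U k, hw.toLp w⟫ := rfl
  rw [h4, h2]
  refine integral_congr_ae ((hu k).coeFn_toLp.mono fun x hx => ?_)
  simp only [U, hx]

/-- The weak `L²` limit, tested on indicators, inherits the bound `M`. Truncation and the uniform
bound extend the convergence to `L¹` tests. On the set where `u k` converges pointwise, dominated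
convergence identifies the limit. -/
lemma exists_weakStar_limit_of_isFiniteMeasure (μ : Measure X) [IsFiniteMeasure μ]
    {u : ℕ → X → ℝ} {M : ℝ} (hM0 : 0 ≤ M) (hm : ∀ k, Measurable (u k))
    (hM : ∀ k x, |u k x| ≤ M) :
    ∃ v : X → ℝ, Measurable v ∧ (∀ x, |v x| ≤ M) ∧
      (∀ w, Integrable w μ →
        Tendsto (fun k => ∫ x, u k x * w x ∂μ) (hyperfilter ℕ) (𝓝 (∫ x, v x * w x ∂μ))) ∧
      ∀ᵐ x ∂μ, ∀ l, Tendsto (fun k => u k x) atTop (𝓝 l) → v x = l := by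
  obtain ⟨v₀, hv₀, hlim⟩ := exists_weak_limit_memLp_two μ hM0 hm hM
  have hv₀i : Integrable v₀ μ := hv₀.integrable (by norm_num)
  have hui : ∀ k, Integrable (u k) μ := fun k =>
    Integrable.of_bound (hm k).aestronglyMeasurable M (ae_of_all _ (hM k))
  have hset : ∀ s, MeasurableSet s →
      Tendsto (fun k => ∫ x in s, u k x ∂μ) (hyperfilter ℕ) (𝓝 (∫ x in s, v₀ x ∂μ)) := by
    intro s hs
    have := hlim (s.indicator fun _ => (1 : ℝ)) ((memLp_const 1).indicator hs)
    have e : ∀ z : X → ℝ, ∫ x, z x * s.indicator (fun _ => (1 : ℝ)) x ∂μ = ∫ x in s, z x ∂μ := by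
      intro z
      rw [← integral_indicator hs]
      congr 1; ext x; by_cases hx : x ∈ s <;> simp [hx]
    simpa only [e] using this
  have hup : v₀ ≤ᵐ[μ] fun _ => M := by
    refine ae_le_of_forall_setIntegral_le hv₀i (integrable_const M) fun s hs _ => ?_
    refine le_of_tendsto (hset s hs) (Eventually.of_forall fun k => ?_)
    exact integral_mono (hui k).integrableOn (integrable_const M)
      fun x => (abs_le.1 (hM k x)).2
  have hlo : (fun _ => -M) ≤ᵐ[μ] v₀ := by
    refine ae_le_of_forall_setIntegral_le (integrable_const (-M)) hv₀i fun s hs _ => ?_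
    refine ge_of_tendsto (hset s hs) (Eventually.of_forall fun k => ?_)
    exact integral_mono (integrable_const (-M)) (hui k).integrableOn
      fun x => (abs_le.1 (hM k x)).1
  obtain ⟨v₁, hv₁m, hv₁⟩ := hv₀i.aestronglyMeasurable
  -- Clamping a measurable representative makes the bound hold everywhere without changing the
  -- function a.e.
  let v : X → ℝ := fun x => max (-M) (min M (v₁ x))
  have hvm : Measurable v := measurable_const.max (measurable_const.min hv₁m.measurable)
  have hv : v₀ =ᵐ[μ] v := by
    filter_upwards [hup, hlo, hv₁] with x h1 h2 h3
    simp only [v, ← h3, min_eq_right h1, max_eq_right h2]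
  have hvM : ∀ x, |v x| ≤ M := fun x =>
    abs_le.2 ⟨le_max_left _ _, max_le (by linarith) (min_le_left _ _)⟩
  refine ⟨v, hvm, hvM, fun w hw => ?_, ?_⟩
  · have hbd : ∀ z : X → ℝ, Measurable z → (∀ x, |z x| ≤ M) → ∀ y, Integrable y μ →
        Integrable (fun x => z x * y x) μ := fun z hz hzM y hy =>
      hy.bdd_mul (c := M) hz.aestronglyMeasurable (ae_of_all _ hzM)
    obtain ⟨w', hw'm, hww'⟩ := hw.aestronglyMeasurable
    have hw'i : Integrable w' μ := hw.congr hww'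
    have ew : ∀ z : X → ℝ, ∫ x, z x * w x ∂μ = ∫ x, z x * w' x ∂μ := fun z =>
      integral_congr_ae (hww'.mono fun x hx => by simp only [hx])
    simp only [ew]
    let t : ℕ → X → ℝ := fun N => {x | |w' x| ≤ N}.indicator w'
    have hs : ∀ N : ℕ, MeasurableSet {x | |w' x| ≤ N} := fun N =>
      measurableSet_le hw'm.measurable.abs measurable_const
    have ht : ∀ N, Integrable (t N) μ := fun N => hw'i.indicator (hs N)
    have ht2 : ∀ N, MemLp (t N) 2 μ := by
      intro N
      refine MemLp.of_bound (ht N).aestronglyMeasurable N (ae_of_all _ fun x => ?_)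
      by_cases hx : |w' x| ≤ N
      · simp only [t]; rw [indicator_of_mem (by exact hx)]; exact hx
      · simp only [t]; rw [indicator_of_notMem (by exact hx)]; simp
    have htend : Tendsto (fun N => ∫ x, |w' x - t N x| ∂μ) atTop (𝓝 0) := by
      have := tendsto_integral_of_dominated_convergence (μ := μ)
        (F := fun N x => |w' x - t N x|) (f := fun _ => 0) (fun x => |w' x|)
        (fun N => (hw'i.sub (ht N)).abs.aestronglyMeasurable) hw'i.abs
        (fun N => ae_of_all _ fun x => ?_) (ae_of_all _ fun x => ?_)
      · simpa using this
      · by_cases hx : |w' x| ≤ N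
        · simp only [t]; rw [indicator_of_mem (by exact hx)]; simp
        · simp only [t]; rw [indicator_of_notMem (by exact hx)]; simp
      · refine tendsto_const_nhds.congr' ?_
        obtain ⟨N₀, hN₀⟩ := exists_nat_ge |w' x|
        filter_upwards [eventually_ge_atTop N₀] with N hN
        have hx : |w' x| ≤ N := hN₀.trans (by exact_mod_cast hN)
        simp only [t]; rw [indicator_of_mem (by exact hx)]; simp
    have hdiff : ∀ z : X → ℝ, Measurable z → (∀ x, |z x| ≤ M) → ∀ N,
        |(∫ x, z x * w' x ∂μ) - ∫ x, z x * t N x ∂μ| ≤ M * ∫ x, |w' x - t N x| ∂μ := by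
      intro z hz hzM N
      rw [← integral_sub (hbd z hz hzM _ hw'i) (hbd z hz hzM _ (ht N)), ← Real.norm_eq_abs,
        ← integral_const_mul]
      refine norm_integral_le_of_norm_le ((hw'i.sub (ht N)).abs.const_mul M)
        (ae_of_all _ fun x => ?_)
      rw [← mul_sub, norm_mul]
      exact mul_le_mul_of_nonneg_right (hzM x) (norm_nonneg _)
    rw [Metric.tendsto_nhds]
    intro ε hε
    have hMt : Tendsto (fun N => M * ∫ x, |w' x - t N x| ∂μ) atTop (𝓝 0) := by
      simpa using htend.const_mul M
    obtain ⟨N, hN⟩ := (hMt.eventually (gt_mem_nhds (by positivity : 0 < ε / 3))).exists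
    have h1 := Metric.tendsto_nhds.1 (hlim (t N) (ht2 N)) (ε / 3) (by positivity)
    filter_upwards [h1] with k hk
    have e2 : ∫ x, v₀ x * t N x ∂μ = ∫ x, v x * t N x ∂μ :=
      integral_congr_ae (hv.mono fun x hx => by simp only [hx])
    rw [e2, Real.dist_eq] at hk
    rw [Real.dist_eq]
    have a1 := hdiff (u k) (hm k) (hM k) N
    have a2 := hdiff v hvm hvM N
    rw [abs_le] at a1 a2
    rw [abs_lt] at hk ⊢
    constructor <;> linarith
  · classical
    -- Cutting off to the set of convergence gives a sequence converging everywhere, with a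
    -- measurable limit `L`.
    let s : Set X := {x | ∃ l, Tendsto (fun k => u k x) atTop (𝓝 l)}
    have hs : MeasurableSet s := measurableSet_exists_tendsto hm
    let L : X → ℝ := fun x => if h : x ∈ s then h.choose else 0
    have hL : ∀ x, Tendsto (fun k => s.indicator (u k) x) atTop (𝓝 (L x)) := by
      intro x
      by_cases hx : x ∈ s
      · simp only [indicator_of_mem hx, L, dif_pos hx]; exact hx.choose_spec
      · simp only [indicator_of_notMem hx, L, dif_neg hx]; exact tendsto_const_nhds
    have hLm : Measurable L :=
      measurable_of_tendsto_metrizable (fun k => (hm k).indicator hs) (tendsto_pi_nhds.2 hL)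
    have hind : ∀ k x, |s.indicator (u k) x| ≤ M := fun k x => by
      by_cases hx : x ∈ s
      · simpa [hx] using hM k x
      · simpa [hx] using hM0
    have hLM : ∀ x, |L x| ≤ M := fun x =>
      le_of_tendsto (hL x).abs (Eventually.of_forall fun k => hind k x)
    have hLi : Integrable L μ := Integrable.of_bound hLm.aestronglyMeasurable M (ae_of_all _ hLM)
    have hae : s.indicator v₀ =ᵐ[μ] L := by
      refine Integrable.ae_eq_of_forall_setIntegral_eq _ _ (hv₀i.indicator hs) hLi
        fun a ha _ => ?_
      have h1 := hset (a ∩ s) (ha.inter hs)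
      simp only [← setIntegral_indicator hs] at h1
      have h2 : Tendsto (fun k => ∫ x in a, s.indicator (u k) x ∂μ) atTop (𝓝 (∫ x in a, L x ∂μ)) :=
        tendsto_integral_of_dominated_convergence (fun _ => M)
          (fun k => ((hm k).indicator hs).aestronglyMeasurable) (integrable_const M)
          (fun k => ae_of_all _ (hind k)) (ae_of_all _ hL)
      exact tendsto_nhds_unique h1 (h2.mono_left Nat.hyperfilter_le_atTop)
    filter_upwards [hae, hv] with x h1 h2 l hl
    have hx : x ∈ s := ⟨l, hl⟩
    rw [indicator_of_mem hx] at h1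
    rw [← h2, h1]
    have := hL x
    simp only [indicator_of_mem hx] at this
    exact tendsto_nhds_unique this hl

/-- Bounded sequences in `L^∞` of a `σ`-finite measure converge weakly-star along a nonprincipal
ultrafilter, and the limit agrees with the pointwise limit wherever the latter exists. -/
lemma exists_weakStar_limit (ν : Measure X) [SigmaFinite ν]
    {u : ℕ → X → ℝ} {M : ℝ} (hM0 : 0 ≤ M) (hm : ∀ k, Measurable (u k))
    (hM : ∀ k x, |u k x| ≤ M) :
    ∃ v : X → ℝ, Measurable v ∧ (∀ x, |v x| ≤ M) ∧
      (∀ w, Integrable w ν →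
        Tendsto (fun k => ∫ x, u k x * w x ∂ν) (hyperfilter ℕ) (𝓝 (∫ x, v x * w x ∂ν))) ∧
      ∀ᵐ x ∂ν, ∀ l, Tendsto (fun k => u k x) atTop (𝓝 l) → v x = l := by
  -- Pass to a finite measure dominating `ν`; an `L¹(ν)` test function becomes an `L¹` one after
  -- multiplication by the density of `ν`.
  have hac : ν ≪ ν.toFinite := absolutelyContinuous_toFinite ν
  obtain ⟨v, h1, h2, h3, h4⟩ := exists_weakStar_limit_of_isFiniteMeasure ν.toFinite hM0 hm hM
  refine ⟨v, h1, h2, fun w hw => ?_, hac.ae_le h4⟩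
  have hw' := (integrable_rnDeriv_smul_iff hac).2 hw
  have e : ∀ z : X → ℝ, ∫ x, z x * w x ∂ν
      = ∫ x, z x * (ν.rnDeriv ν.toFinite x).toReal • w x ∂ν.toFinite := by
    intro z
    rw [← integral_rnDeriv_smul hac]
    congr 1; ext x; simp only [smul_eq_mul]; ring
  simp only [e]
  exact h3 _ hw'

end WeakStar

end

/-! ### Riesz representation of order bounded functionals, and of locally bounded functionals on
smooth functions. -/

section

section Riesz

open scoped CompactlySupported NNReal
open CompactlySupportedContinuousMap

variable {X : Type*} [TopologicalSpace X]

/-- The Riesz decomposition property, with `k₁ = k ⊓ h₁` and `k₂ = k - k₁`; it makes the supremum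
defining the positive part additive. -/
lemma exists_add_of_le_add {k h₁ h₂ : C_c(X, ℝ≥0)} (h : k ≤ h₁ + h₂) :
    ∃ k₁ k₂ : C_c(X, ℝ≥0), k₁ ≤ h₁ ∧ k₂ ≤ h₂ ∧ k = k₁ + k₂ := by
  obtain ⟨k₂, hk₂⟩ := CompactlySupportedContinuousMap.exists_add_of_le
    (inf_le_left : k ⊓ h₁ ≤ k)
  refine ⟨k ⊓ h₁, k₂, inf_le_right, fun x => ?_, hk₂.symm⟩
  have h1 := DFunLike.congr_fun hk₂ x
  have h2 : k x ≤ h₁ x + h₂ x := h x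
  simp only [coe_add, Pi.add_apply, inf_apply] at h1
  change k₂ x ≤ h₂ x
  rcases le_total (k x) (h₁ x) with h3 | h3
  · rw [inf_eq_left.2 h3] at h1
    have : k₂ x = 0 := by simpa using h1
    simp [this]
  · rw [inf_eq_right.2 h3] at h1
    rw [← h1] at h2
    exact le_of_add_le_add_left h2

/-- The values defining the positive part of a functional at `h`. -/
def posPartSet (S : C_c(X, ℝ) →ₗ[ℝ] ℝ) (h : C_c(X, ℝ≥0)) : Set ℝ :=
  {t | ∃ k : C_c(X, ℝ≥0), k ≤ h ∧ t = S k.toReal}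

lemma zero_mem_posPartSet (S : C_c(X, ℝ) →ₗ[ℝ] ℝ) (h : C_c(X, ℝ≥0)) : 0 ∈ posPartSet S h := by
  refine ⟨0, fun x => by simp, ?_⟩
  have : (0 : C_c(X, ℝ≥0)).toReal = 0 := by ext; simp
  rw [this, map_zero]

open Pointwise in
lemma posPartSet_add (S : C_c(X, ℝ) →ₗ[ℝ] ℝ) (h₁ h₂ : C_c(X, ℝ≥0)) :
    posPartSet S (h₁ + h₂) = posPartSet S h₁ + posPartSet S h₂ := by
  ext t
  rw [Set.mem_add]
  constructor
  · rintro ⟨k, hk, rfl⟩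
    obtain ⟨k₁, k₂, h1, h2, rfl⟩ := exists_add_of_le_add hk
    exact ⟨_, ⟨k₁, h1, rfl⟩, _, ⟨k₂, h2, rfl⟩, by simp⟩
  · rintro ⟨_, ⟨k₁, h1, rfl⟩, _, ⟨k₂, h2, rfl⟩, rfl⟩
    exact ⟨k₁ + k₂, fun x => add_le_add (h1 x) (h2 x), by simp⟩

open Pointwise in
lemma posPartSet_smul (S : C_c(X, ℝ) →ₗ[ℝ] ℝ) {c : ℝ≥0} (hc : c ≠ 0) (h : C_c(X, ℝ≥0)) :
    posPartSet S (c • h) = (c : ℝ) • posPartSet S h := by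
  ext t
  rw [Set.mem_smul_set]
  constructor
  · rintro ⟨k, hk, rfl⟩
    refine ⟨_, ⟨c⁻¹ • k, fun x => ?_, rfl⟩, ?_⟩
    · have h1 : k x ≤ c * h x := hk x
      change c⁻¹ * k x ≤ h x
      rwa [inv_mul_le_iff₀ (pos_iff_ne_zero.2 hc)]
    · rw [toReal_smul, NNReal.smul_def, map_smul, smul_smul]
      simp [hc]
  · rintro ⟨_, ⟨k, hk, rfl⟩, rfl⟩
    refine ⟨c • k, fun x => ?_, ?_⟩
    · change c * k x ≤ c * h x
      gcongr; exact hk x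
    · rw [toReal_smul, NNReal.smul_def, map_smul]

/-- The positive part of an order bounded functional on `C_c(X)`. -/
def posPart (S : C_c(X, ℝ) →ₗ[ℝ] ℝ) (hS : ∀ h, BddAbove (posPartSet S h)) :
    C_c(X, ℝ≥0) →ₗ[ℝ≥0] ℝ≥0 where
  toFun h := ⟨sSup (posPartSet S h), le_csSup (hS h) (zero_mem_posPartSet S h)⟩
  map_add' h₁ h₂ := by
    apply NNReal.eq
    change sSup (posPartSet S (h₁ + h₂)) = sSup (posPartSet S h₁) + sSup (posPartSet S h₂)
    rw [posPartSet_add, csSup_add ⟨0, zero_mem_posPartSet S h₁⟩ (hS h₁)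
      ⟨0, zero_mem_posPartSet S h₂⟩ (hS h₂)]
  map_smul' c h := by
    apply NNReal.eq
    change sSup (posPartSet S (c • h)) = c * sSup (posPartSet S h)
    rcases eq_or_ne c 0 with rfl | hc
    · rw [zero_smul, NNReal.coe_zero, zero_mul]
      have : posPartSet S 0 = {0} := by
        refine Set.eq_singleton_iff_unique_mem.2 ⟨zero_mem_posPartSet S 0, ?_⟩
        rintro _ ⟨k, hk, rfl⟩
        have : k.toReal = 0 := by
          ext x
          have h1 : k x ≤ 0 := hk x
          simp [nonpos_iff_eq_zero.1 h1]
        rw [this, map_zero]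
      rw [this, csSup_singleton]
    · rw [posPartSet_smul S hc, Real.sSup_smul_of_nonneg c.coe_nonneg, smul_eq_mul]

lemma le_posPart (S : C_c(X, ℝ) →ₗ[ℝ] ℝ) (hS : ∀ h, BddAbove (posPartSet S h))
    (h : C_c(X, ℝ≥0)) : S h.toReal ≤ posPart S hS h :=
  le_csSup (hS h) ⟨h, le_rfl, rfl⟩

/-- The negative part of an order bounded functional on `C_c(X)`. -/
def negPart (S : C_c(X, ℝ) →ₗ[ℝ] ℝ) (hS : ∀ h, BddAbove (posPartSet S h)) :
    C_c(X, ℝ≥0) →ₗ[ℝ≥0] ℝ≥0 where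
  toFun h := ⟨posPart S hS h - S h.toReal, sub_nonneg.2 (le_posPart S hS h)⟩
  map_add' h₁ h₂ := by
    apply NNReal.eq
    change (posPart S hS (h₁ + h₂) : ℝ) - S (h₁ + h₂).toReal
      = (posPart S hS h₁ - S h₁.toReal) + (posPart S hS h₂ - S h₂.toReal)
    rw [map_add, toReal_add, map_add, NNReal.coe_add]; ring
  map_smul' c h := by
    apply NNReal.eq
    change (posPart S hS (c • h) : ℝ) - S (c • h).toReal = c * (posPart S hS h - S h.toReal)
    rw [map_smul, toReal_smul, NNReal.smul_def c h.toReal, map_smul, smul_eq_mul, smul_eq_mul,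
      NNReal.coe_mul]; ring

/-- An order bounded functional on `C_c(X)` is a difference of two Radon measures. -/
lemma exists_measures_of_orderBounded [T2Space X] [LocallyCompactSpace X]
    [MeasurableSpace X] [BorelSpace X]
    (S : C_c(X, ℝ) →ₗ[ℝ] ℝ) (hS : ∀ h, BddAbove (posPartSet S h)) :
    ∃ μ₁ μ₂ : Measure X, IsLocallyFiniteMeasure μ₁ ∧ IsLocallyFiniteMeasure μ₂ ∧
      ∀ h : C_c(X, ℝ), S h = ∫ x, h x ∂μ₁ - ∫ x, h x ∂μ₂ := by
  refine ⟨NNRealRMK.rieszMeasure (posPart S hS), NNRealRMK.rieszMeasure (negPart S hS),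
    inferInstance, inferInstance, fun h => ?_⟩
  have e : ∀ h : C_c(X, ℝ≥0), S h.toReal
      = ∫ x, (h x : ℝ) ∂NNRealRMK.rieszMeasure (posPart S hS)
        - ∫ x, (h x : ℝ) ∂NNRealRMK.rieszMeasure (negPart S hS) := by
    intro h
    rw [NNRealRMK.integral_rieszMeasure, NNRealRMK.integral_rieszMeasure]
    change _ = (posPart S hS h : ℝ) - (posPart S hS h - S h.toReal)
    ring
  have hd : h = h.nnrealPart.toReal - (-h).nnrealPart.toReal := by
    ext x
    simp only [coe_sub, Pi.sub_apply, toReal_apply, nnrealPart_apply, coe_neg, Pi.neg_apply,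
      Real.coe_toNNReal']
    rcases le_total 0 (h x) with h0 | h0
    · simp [h0]
    · simp [h0]
  have hi : ∀ (μ : Measure X) [IsFiniteMeasureOnCompacts μ], ∫ x, h x ∂μ
      = ∫ x, (h.nnrealPart x : ℝ) ∂μ - ∫ x, ((-h).nnrealPart x : ℝ) ∂μ := by
    intro μ _
    have hg : ∀ g : C_c(X, ℝ≥0), Integrable (fun x => (g x : ℝ)) μ := fun g =>
      g.toReal.integrable.congr (ae_of_all _ fun x => toReal_apply g x)
    rw [← integral_sub (hg _) (hg _)]
    congr 1; ext x
    conv_lhs => rw [hd]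
    simp
  conv_lhs => rw [hd]
  rw [map_sub, e, e, hi, hi]
  ring

end Riesz

section SmoothRiesz

open scoped CompactlySupported NNReal

variable {n : ℕ}

lemma exists_norm_smoothing_sub_le {V : Type*} [NormedAddCommGroup V] [NormedSpace ℝ V]
    [CompleteSpace V] {u : Rn n → V} (hu : ContDiff ℝ ∞ u) (hc : HasCompactSupport u) :
    ∃ K : ℝ, ∀ k x, ‖smoothing k u x - u x‖ ≤ K * (bump n k).rOut := by
  obtain ⟨K, hK⟩ := hu.lipschitzWith_of_hasCompactSupport hc (by simp)
  refine ⟨K, fun k x => norm_smoothing_sub_le k hu.continuous.locallyIntegrable fun y hy => ?_⟩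
  have := hK.dist_le_mul y x
  rw [dist_eq_norm, dist_eq_norm, norm_sub_rev y x] at this
  exact this.trans (by gcongr)

lemma exists_norm_bound {V : Type*} [NormedAddCommGroup V] {u : Rn n → V}
    (hc : HasCompactSupport u) : ∃ R : ℝ, ∀ x, R ≤ ‖x‖ → u x = 0 := by
  obtain ⟨R, hR⟩ := hc.isCompact.isBounded.subset_ball 0
  refine ⟨R, fun x hx => image_eq_zero_of_notMem_tsupport fun h => ?_⟩
  have := hR h
  simp at this; linarith

/-- A locally bounded linear functional on `C_c^∞(ℝⁿ)` is a difference of two Radon measures. -/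
lemma exists_measures_of_locallyBounded (T : (Rn n → ℝ) → ℝ)
    (hadd : ∀ u v, ContDiff ℝ ∞ u → HasCompactSupport u → ContDiff ℝ ∞ v → HasCompactSupport v →
      T (fun x => u x + v x) = T u + T v)
    (hsmul : ∀ (c : ℝ) u, ContDiff ℝ ∞ u → HasCompactSupport u → T (fun x => c • u x) = c * T u)
    (hbd : ∀ R : ℝ, ∃ C : ℝ, ∀ u, ContDiff ℝ ∞ u → HasCompactSupport u →
      (∀ x, R ≤ ‖x‖ → u x = 0) → ∀ c : ℝ, (∀ x, |u x| ≤ c) → |T u| ≤ C * c) :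
    ∃ μ₁ μ₂ : Measure (Rn n), IsLocallyFiniteMeasure μ₁ ∧ IsLocallyFiniteMeasure μ₂ ∧
      ∀ u, ContDiff ℝ ∞ u → HasCompactSupport u → T u = ∫ x, u x ∂μ₁ - ∫ x, u x ∂μ₂ := by
  have hsm : ∀ (h : C_c(Rn n, ℝ)) k, ContDiff ℝ ∞ (smoothing k h) ∧
      HasCompactSupport (smoothing k h) := fun h k =>
    ⟨contDiff_smoothing k h.continuous.locallyIntegrable,
      hasCompactSupport_smoothing k h.hasCompactSupport⟩
  choose C hC using hbd
  have hTk : ∀ (h : C_c(Rn n, ℝ)) (R c : ℝ), (∀ x, R ≤ ‖x‖ → h x = 0) → (∀ x, |h x| ≤ c) →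
      ∀ k, |T (smoothing k h)| ≤ C (R + 1) * c := fun h R c hR hc k =>
    hC (R + 1) _ (hsm h k).1 (hsm h k).2 (fun x hx => smoothing_eq_zero k hR hx) c
      (norm_smoothing_le (V := ℝ) k hc)
  -- `T` is extended to `C_c` as an ultrafilter limit of `T (ρ_k * h)`; such limits are
  -- automatically linear. Mollifying enlarges supports by at most 1, hence the constant `C (R +
  -- 1)`.
  have hex : ∀ h : C_c(Rn n, ℝ), ∃ s : ℝ,
      Tendsto (fun k => T (smoothing k h)) (hyperfilter ℕ) (𝓝 s) := by
    intro h
    obtain ⟨R, hR⟩ := exists_norm_bound h.hasCompactSupport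
    obtain ⟨c, hc⟩ := h.hasCompactSupport.exists_bound_of_continuous h.continuous
    obtain ⟨s, -, hs⟩ := (isCompact_Icc (a := -(C (R + 1) * c))
      (b := C (R + 1) * c)).ultrafilter_le_nhds
      ((hyperfilter ℕ : Ultrafilter ℕ).map fun k => T (smoothing k h)) (by
        rw [le_principal_iff]
        exact Filter.mem_map.2 (Eventually.of_forall fun k => abs_le.1 (hTk h R c hR hc k)))
    exact ⟨s, hs⟩
  choose s hs using hex
  let S : C_c(Rn n, ℝ) →ₗ[ℝ] ℝ :=
    { toFun := s
      map_add' := fun h₁ h₂ => by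
        refine tendsto_nhds_unique (hs (h₁ + h₂)) (((hs h₁).add (hs h₂)).congr fun k => ?_)
        rw [← hadd _ _ (hsm h₁ k).1 (hsm h₁ k).2 (hsm h₂ k).1 (hsm h₂ k).2,
          ← smoothing_add k (u := (h₁ : Rn n → ℝ)) (v := (h₂ : Rn n → ℝ))
            h₁.continuous.locallyIntegrable h₂.continuous.locallyIntegrable]
        rfl
      map_smul' := fun c h => by
        refine tendsto_nhds_unique (hs (c • h)) (((hs h).const_mul c).congr fun k => ?_)
        rw [← hsmul c _ (hsm h k).1 (hsm h k).2, ← smoothing_const_smul]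
        rfl }
  have hSbd : ∀ (h : C_c(Rn n, ℝ)) (R c : ℝ), (∀ x, R ≤ ‖x‖ → h x = 0) → (∀ x, |h x| ≤ c) →
      S h ≤ C (R + 1) * c := fun h R c hR hc =>
    le_of_tendsto (hs h) (Eventually.of_forall fun k => (abs_le.1 (hTk h R c hR hc k)).2)
  obtain ⟨μ₁, μ₂, h1, h2, h12⟩ := exists_measures_of_orderBounded S (fun h => by
    obtain ⟨R, hR⟩ := exists_norm_bound h.toReal.hasCompactSupport
    obtain ⟨c, hc⟩ := h.toReal.hasCompactSupport.exists_bound_of_continuous h.toReal.continuous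
    refine ⟨C (R + 1) * c, ?_⟩
    rintro _ ⟨k, hk, rfl⟩
    have hk' : ∀ x, (k x : ℝ) ≤ h x := fun x => NNReal.coe_le_coe.2 (hk x)
    refine hSbd _ R c (fun x hx => ?_) fun x => ?_
    · have h1 := hR x hx
      have h2 := hk' x
      simp only [CompactlySupportedContinuousMap.toReal_apply] at h1 ⊢
      exact le_antisymm (h2.trans h1.le) (k x).2
    · have h1 := hc x
      have h2 := hk' x
      simp only [CompactlySupportedContinuousMap.toReal_apply, Real.norm_eq_abs,
        NNReal.abs_eq] at h1 ⊢
      exact h2.trans h1)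
  refine ⟨μ₁, μ₂, h1, h2, fun u hu hc => ?_⟩
  let h : C_c(Rn n, ℝ) := ⟨⟨u, hu.continuous⟩, hc⟩
  rw [show ∫ x, u x ∂μ₁ - ∫ x, u x ∂μ₂ = S h from (h12 h).symm]
  refine tendsto_nhds_unique ?_ (hs h)
  refine Tendsto.mono_left ?_ Nat.hyperfilter_le_atTop
  obtain ⟨R, hR⟩ := exists_norm_bound hc
  obtain ⟨K, hK⟩ := exists_norm_smoothing_sub_le hu hc
  have hneg : ContDiff ℝ ∞ (fun x => (-1 : ℝ) • u x) := (contDiff_const (c := (-1 : ℝ))).smul hu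
  have hnegc : HasCompactSupport (fun x => (-1 : ℝ) • u x) :=
    HasCompactSupport.smul_left (f := fun _ => (-1 : ℝ)) hc
  have hk : ∀ k, ContDiff ℝ ∞ (smoothing k u) ∧ HasCompactSupport (smoothing k u) := hsm h
  have e : ∀ k, T (smoothing k h) - T u = T (fun x => smoothing k u x + (-1 : ℝ) • u x) := by
    intro k
    rw [hadd _ _ (hk k).1 (hk k).2 hneg hnegc, hsmul _ _ hu hc, neg_one_mul, ← sub_eq_add_neg]
    rfl
  have hlim : Tendsto (fun k => C (R + 1) * (K * (bump n k).rOut)) atTop (𝓝 0) := by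
    simpa using ((tendsto_bump_rOut n).const_mul K).const_mul (C (R + 1))
  -- For smooth `u` the mollifications converge uniformly with supports in a fixed ball, so the
  -- extension agrees with `T`.
  have h0 : Tendsto (fun k => T (smoothing k h) - T u) atTop (𝓝 0) := by
    refine squeeze_zero_norm (fun k => ?_) hlim
    rw [e, Real.norm_eq_abs]
    refine hC (R + 1) _ ((hk k).1.add hneg) ((hk k).2.add hnegc) (fun x hx => ?_) _ fun x => ?_
    · rw [smoothing_eq_zero k hR hx, hR x (by linarith)]; simp
    · have := hK k x
      simpa [sub_eq_add_neg] using this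
  simpa using h0.add_const (T u)

end SmoothRiesz

end

/-! ### Densities of vector Radon measures, and Riesz representation on test fields. -/

section

open scoped NNReal

variable {n : ℕ} {V : Type*} [NormedAddCommGroup V] [NormedSpace ℝ V]

/-- The density of `μ` with respect to a larger measure `ν`. -/
def dens (μ ν : Measure (Rn n)) (x : Rn n) : ℝ := min 1 (μ.rnDeriv ν x).toReal

lemma isBddBorel_dens (μ ν : Measure (Rn n)) : IsBddBorel (dens μ ν) 1 :=
  ⟨measurable_const.min (Measure.measurable_rnDeriv _ _).ennreal_toReal, fun x =>
    abs_le.2 ⟨le_trans (by norm_num) (le_min zero_le_one ENNReal.toReal_nonneg), min_le_left _ _⟩⟩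

/-- If `μ ≤ ν`, the Radon–Nikodym derivative is at most 1 a.e., so the cap in `dens`, which makes it
bounded everywhere, costs nothing. -/
lemma integral_dens_smul {μ ν : Measure (Rn n)} [SigmaFinite μ] [SigmaFinite ν] (h : μ ≤ ν)
    (F : Rn n → V) : ∫ x, dens μ ν x • F x ∂ν = ∫ x, F x ∂μ := by
  rw [← integral_rnDeriv_smul (Measure.absolutelyContinuous_of_le h)]
  refine integral_congr_ae ((Measure.rnDeriv_le_one_of_le h).mono fun x hx => ?_)
  simp only [dens]
  rw [min_eq_right]
  exact ENNReal.toReal_le_of_le_ofReal zero_le_one (by simpa using hx)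

lemma setIntegral_dens_smul {μ ν : Measure (Rn n)} [SigmaFinite μ] [SigmaFinite ν] (h : μ ≤ ν)
    (F : Rn n → V) {B : Set (Rn n)} (hB : MeasurableSet B) :
    ∫ x in B, dens μ ν x • F x ∂ν = ∫ x in B, F x ∂μ := by
  rw [← integral_indicator hB, ← integral_indicator hB, ← integral_dens_smul h]
  congr 1; ext1 x
  by_cases hx : x ∈ B <;> simp [hx]

/-- A bounded Borel density with respect to a Radon measure defines a vector Radon measure. -/
lemma exists_vecRadon_of_density (ν : Measure (Rn n)) [IsLocallyFiniteMeasure ν]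
    {d : Rn n → Rn n} (hd : Measurable d) {C : ℝ} (hC : ∀ x, ‖d x‖ ≤ C) :
    ∃ μ : VecRadon n, ∀ φ : Rn n → Rn n, μ.pairing φ = ∫ x, ⟪φ x, d x⟫ ∂ν := by
  have hle : ν.withDensity (fun x => (‖d x‖₊ : ℝ≥0∞)) ≤ C.toNNReal • ν := by
    refine Measure.le_iff.2 fun s hs => ?_
    rw [withDensity_apply _ hs, Measure.smul_apply]
    calc ∫⁻ x in s, (‖d x‖₊ : ℝ≥0∞) ∂ν ≤ ∫⁻ _ in s, (C.toNNReal : ℝ≥0∞) ∂ν := by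
          refine lintegral_mono fun x => ?_
          exact ENNReal.coe_le_coe.2 (NNReal.le_toNNReal_of_coe_le (hC x))
      _ = C.toNNReal • ν s := by rw [setLIntegral_const]; rfl
  -- Polar decomposition of `d ν`; the zeros of `d`, where the direction is not a unit vector, are
  -- null for `‖d‖ ν`.
  let μ : VecRadon n :=
    { var := ν.withDensity fun x => (‖d x‖₊ : ℝ≥0∞)
      locallyFinite := Measure.isLocallyFiniteMeasure_of_le hle
      dir := fun x => ‖d x‖⁻¹ • d x
      measurable_dir := hd.norm.inv.smul hd
      norm_dir := by
        rw [ae_withDensity_iff (by fun_prop)]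
        refine ae_of_all _ fun x hx => ?_
        have : ‖d x‖ ≠ 0 := by simpa using hx
        rw [norm_smul, norm_inv, norm_norm, inv_mul_cancel₀ this] }
  refine ⟨μ, fun φ => ?_⟩
  change ∫ x, ⟪φ x, ‖d x‖⁻¹ • d x⟫ ∂(ν.withDensity fun x => (‖d x‖₊ : ℝ≥0∞)) = _
  rw [integral_withDensity_eq_integral_smul (by fun_prop)]
  congr 1; ext x
  rw [NNReal.smul_def, smul_eq_mul, coe_nnnorm, real_inner_smul_right]
  rcases eq_or_ne (d x) 0 with h | h
  · simp [h]
  · rw [mul_inv_cancel_left₀ (norm_ne_zero_iff.2 h)]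

/-- Polar pairs cannot be added directly; as densities over a common dominating measure they can,
and the everywhere bound keeps all integrals finite on bounded sets. -/
lemma VecRadon.exists_density (μ : VecRadon n) {ν : Measure (Rn n)} [IsLocallyFiniteMeasure ν]
    (hle : μ.var ≤ ν) {h : Rn n → ℝ} {M : ℝ} (hh : IsBddBorel h M) :
    ∃ d : Rn n → Rn n, Measurable d ∧ (∀ x, ‖d x‖ ≤ M) ∧
      (∀ φ : Rn n → Rn n, ∫ x, h x * ⟪φ x, μ.dir x⟫ ∂μ.var = ∫ x, ⟪φ x, d x⟫ ∂ν) ∧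
      ∀ B, MeasurableSet B → μ.mulVal h B = ∫ x in B, d x ∂ν := by
  have := μ.locallyFinite
  have hm := μ.measurable_dir
  -- The direction is a unit vector only a.e.; setting it to zero elsewhere gives a bound at every
  -- point.
  let σ : Rn n → Rn n := {x | ‖μ.dir x‖ = 1}.indicator μ.dir
  have hs : MeasurableSet {x | ‖μ.dir x‖ = 1} := hm.norm (measurableSet_singleton 1)
  have hσ : μ.dir =ᵐ[μ.var] σ := μ.norm_dir.mono fun x hx => by
    simp only [σ]; rw [indicator_of_mem (by exact hx)]
  have hσm : Measurable σ := hm.indicator hs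
  have hσ1 : ∀ x, ‖σ x‖ ≤ 1 := fun x => by
    by_cases hx : ‖μ.dir x‖ = 1
    · simp only [σ]; rw [indicator_of_mem (by exact hx)]; exact hx.le
    · simp only [σ]; rw [indicator_of_notMem (by exact hx)]; simp
  have hδ := isBddBorel_dens μ.var ν
  refine ⟨fun x => dens μ.var ν x • h x • σ x, hδ.1.smul (hh.1.smul hσm), fun x => ?_,
    fun φ => ?_, fun B hB => ?_⟩
  · rw [norm_smul, norm_smul]
    calc ‖dens μ.var ν x‖ * (‖h x‖ * ‖σ x‖) ≤ 1 * (M * 1) :=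
          mul_le_mul (hδ.2 x) (mul_le_mul (hh.2 x) (hσ1 x) (norm_nonneg _) hh.nonneg)
            (by positivity) zero_le_one
      _ = M := by ring
  · rw [integral_congr_ae (hσ.mono fun x hx => by rw [hx]), ← integral_dens_smul hle]
    congr 1; ext x
    simp only [real_inner_smul_right, smul_eq_mul]
  · rw [VecRadon.mulVal, setIntegral_dens_smul hle _ hB]
    exact integral_congr_ae (ae_restrict_of_ae (hσ.mono fun x hx => by
      change h x • μ.dir x = h x • σ x; rw [hx]))

lemma VecRadon.mulVal_one (μ : VecRadon n) (B : Set (Rn n)) :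
    VecRadon.mulVal (fun _ => 1) μ B = μ.val B := by
  simp [VecRadon.mulVal, VecRadon.val]

lemma isTestField_smul_const {u : Rn n → ℝ} (hu : ContDiff ℝ ∞ u) (hc : HasCompactSupport u)
    (v : Rn n) : IsTestField fun x => u x • v where
  contDiff := ContDiff.smul hu (contDiff_const (c := v))
  hasCompactSupport := hc.comp_left (g := fun t : ℝ => t • v) (zero_smul ℝ v)

/-- Test fields determine densities. -/
lemma ae_eq_zero_of_forall_integral_inner {ν : Measure (Rn n)} [IsLocallyFiniteMeasure ν]
    {d : Rn n → Rn n} (hd : Measurable d) {C : ℝ} (hC : ∀ x, ‖d x‖ ≤ C)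
    (h : ∀ φ, IsTestField φ → ∫ x, ⟪φ x, d x⟫ ∂ν = 0) : ∀ᵐ x ∂ν, d x = 0 := by
  have hl : LocallyIntegrable d ν := (locallyIntegrable_const C).mono hd.aestronglyMeasurable
    (ae_of_all _ fun x => (hC x).trans (le_abs_self C))
  refine ae_eq_zero_of_integral_contDiff_smul_eq_zero hl fun u hu hc => ?_
  have hi : Integrable (fun x => u x • d x) ν :=
    hl.integrable_smul_left_of_hasCompactSupport hu.continuous hc
  refine ext_inner_left ℝ fun v => ?_
  rw [inner_zero_right, ← integral_inner hi]
  have ht := isTestField_smul_const hu hc v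
  rw [← h _ ht]
  congr 1; ext x
  rw [real_inner_smul_left, real_inner_smul_right]

lemma IsTestField.add {φ ψ : Rn n → Rn n} (hφ : IsTestField φ) (hψ : IsTestField ψ) :
    IsTestField fun x => φ x + ψ x := ⟨hφ.1.add hψ.1, hφ.2.add hψ.2⟩

lemma isTestField_zero : IsTestField fun _ : Rn n => (0 : Rn n) :=
  ⟨contDiff_const, HasCompactSupport.zero⟩

lemma IsTestField.sum {ι : Type*} (s : Finset ι) {φ : ι → Rn n → Rn n}
    (hφ : ∀ i, IsTestField (φ i)) : IsTestField fun x => ∑ i ∈ s, φ i x := by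
  classical
  induction s using Finset.induction_on with
  | empty => simpa using isTestField_zero
  | insert i s hi ih => simpa [Finset.sum_insert hi] using (hφ i).add ih

/-- Riesz representation of locally bounded functionals on test fields. -/
lemma exists_vecRadon_of_locallyBounded (T : (Rn n → Rn n) → ℝ)
    (hadd : ∀ φ ψ, IsTestField φ → IsTestField ψ → T (fun x => φ x + ψ x) = T φ + T ψ)
    (hsmul : ∀ (c : ℝ) φ, IsTestField φ → T (fun x => c • φ x) = c * T φ)
    (hbd : ∀ R : ℝ, ∃ C : ℝ, ∀ φ, IsTestField φ → (∀ x, R ≤ ‖x‖ → φ x = 0) →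
      ∀ c : ℝ, (∀ x, ‖φ x‖ ≤ c) → |T φ| ≤ C * c) :
    ∃ μ : VecRadon n, ∀ φ, IsTestField φ → T φ = μ.pairing φ := by
  classical
  let e : Fin n → Rn n := fun i => EuclideanSpace.single i 1
  have he : ∀ i, ‖e i‖ = 1 := fun i => by simp [e]
  have htest : ∀ i (u : Rn n → ℝ), ContDiff ℝ ∞ u → HasCompactSupport u →
      IsTestField fun x => u x • e i := fun i u hu hc => isTestField_smul_const hu hc (e i)
  have hcomp : ∀ i, ∃ μ₁ μ₂ : Measure (Rn n), IsLocallyFiniteMeasure μ₁ ∧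
      IsLocallyFiniteMeasure μ₂ ∧ ∀ u, ContDiff ℝ ∞ u → HasCompactSupport u →
      T (fun x => u x • e i) = ∫ x, u x ∂μ₁ - ∫ x, u x ∂μ₂ := by
    intro i
    refine exists_measures_of_locallyBounded (fun u => T fun x => u x • e i)
      (fun u v hu huc hv hvc => ?_) (fun c u hu huc => ?_) fun R => ?_
    · simp only [add_smul]
      exact hadd _ _ (htest i u hu huc) (htest i v hv hvc)
    · simp only [smul_assoc]
      exact hsmul c _ (htest i u hu huc)
    · obtain ⟨C, hC⟩ := hbd R
      refine ⟨C, fun u hu huc hR c hc => hC _ (htest i u hu huc) (fun x hx => ?_) c fun x => ?_⟩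
      · rw [hR x hx, zero_smul]
      · rw [norm_smul, he, mul_one]; exact hc x
  choose μ₁ μ₂ h₁ h₂ hT using hcomp
  let ν : Measure (Rn n) := Measure.sum fun i => μ₁ i + μ₂ i
  have hν : IsLocallyFiniteMeasure ν := by
    have h12 : ∀ i, IsFiniteMeasureOnCompacts (μ₁ i + μ₂ i) := fun i => by
      refine ⟨fun K hK => ?_⟩
      rw [Measure.add_apply]
      exact ENNReal.add_lt_top.2 ⟨hK.measure_lt_top, hK.measure_lt_top⟩
    have : IsFiniteMeasureOnCompacts ν := by
      refine ⟨fun K hK => ?_⟩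
      rw [Measure.sum_apply _ hK.isClosed.measurableSet, tsum_fintype]
      exact ENNReal.sum_lt_top.2 fun i _ => hK.measure_lt_top
    infer_instance
  have hle : ∀ i, μ₁ i + μ₂ i ≤ ν := fun i => Measure.le_sum _ i
  have hle₁ : ∀ i, μ₁ i ≤ ν := fun i => le_trans (Measure.le_add_right le_rfl) (hle i)
  have hle₂ : ∀ i, μ₂ i ≤ ν := fun i => le_trans (Measure.le_add_left le_rfl) (hle i)
  let r : Fin n → Rn n → ℝ := fun i x => dens (μ₁ i) ν x - dens (μ₂ i) ν x
  have hr : ∀ i, IsBddBorel (r i) 2 := fun i =>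
    ⟨(isBddBorel_dens _ _).1.sub (isBddBorel_dens _ _).1, fun x => by
      have a := (isBddBorel_dens (μ₁ i) ν).2 x
      have b := (isBddBorel_dens (μ₂ i) ν).2 x
      rw [abs_le] at *
      constructor <;> simp only [r] <;> linarith⟩
  have hrT : ∀ i u, ContDiff ℝ ∞ u → HasCompactSupport u →
      Integrable (fun x => r i x * u x) ν ∧ T (fun x => u x • e i) = ∫ x, r i x * u x ∂ν := by
    intro i u hu huc
    have hui : Integrable u ν := hu.continuous.integrable_of_hasCompactSupport huc
    refine ⟨(hr i).integrable_mul hui, ?_⟩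
    rw [hT i u hu huc, ← integral_dens_smul (hle₁ i), ← integral_dens_smul (hle₂ i),
      ← integral_sub ((isBddBorel_dens _ _).integrable_smul hui)
        ((isBddBorel_dens _ _).integrable_smul hui)]
    congr 1; ext x
    simp only [r, smul_eq_mul]; ring
  obtain ⟨μ, hμ⟩ := exists_vecRadon_of_density ν (d := fun x => ∑ i, r i x • e i) (C := n * 2)
    (Finset.measurable_fun_sum _ fun i _ => (hr i).1.smul_const (e i)) (fun x => by
      refine (norm_sum_le _ _).trans ?_
      calc ∑ i, ‖r i x • e i‖ ≤ ∑ _i : Fin n, (2 : ℝ) := Finset.sum_le_sum fun i _ => by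
            rw [norm_smul, he, mul_one]; exact (hr i).2 x
        _ = n * 2 := by simp)
  refine ⟨μ, fun φ hφ => ?_⟩
  have hφi : ∀ i, ContDiff ℝ ∞ (fun x => φ x i) ∧ HasCompactSupport (fun x => φ x i) := by
    intro i
    refine ⟨(contDiff_euclidean.1 hφ.1) i, ?_⟩
    exact HasCompactSupport.comp_left (g := fun y : Rn n => y i) hφ.2 rfl
  have hsum : ∀ s : Finset (Fin n),
      T (fun x => ∑ i ∈ s, φ x i • e i) = ∑ i ∈ s, T (fun x => φ x i • e i) := by
    intro s
    induction s using Finset.induction_on with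
    | empty =>
      have := hsmul 0 _ isTestField_zero
      simpa using this
    | insert i s hi ih =>
      simp only [Finset.sum_insert hi]
      rw [hadd _ _ (htest i _ (hφi i).1 (hφi i).2)
        (IsTestField.sum s fun i => htest i _ (hφi i).1 (hφi i).2), ih]
  have hdec : φ = fun x => ∑ i, φ x i • e i := by
    ext x j
    simp [e, Pi.single_apply]
  conv_lhs => rw [hdec]
  rw [hsum, hμ, Finset.sum_congr rfl fun i _ => (hrT i _ (hφi i).1 (hφi i).2).2,
    ← integral_finsetSum _ fun i _ => (hrT i _ (hφi i).1 (hφi i).2).1]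
  congr 1; ext x
  rw [inner_sum]
  refine Finset.sum_congr rfl fun i _ => ?_
  rw [real_inner_smul_right]
  simp [e, EuclideanSpace.inner_single_right]

end

/-! ### Passage to the limit in the mollified Leibniz rule. -/

section

open Metric

variable {n : ℕ}

lemma VecRadon.integrable_inner (μ : VecRadon n) {φ : Rn n → Rn n} (hφ : Continuous φ)
    (hc : HasCompactSupport φ) : Integrable (fun x => ⟪φ x, μ.dir x⟫) μ.var := by
  have := μ.locallyFinite
  refine (hφ.norm.integrable_of_hasCompactSupport hc.norm).mono'
    (hφ.measurable.inner μ.measurable_dir).aestronglyMeasurable (μ.norm_dir.mono fun x hx => ?_)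
  simpa [hx] using norm_inner_le_norm (𝕜 := ℝ) (φ x) (μ.dir x)

lemma isTestField_smoothing {F : Rn n → Rn n} (hF : LocallyIntegrable F)
    (hc : HasCompactSupport F) (k : ℕ) : IsTestField (smoothing k F) :=
  ⟨contDiff_smoothing k hF, hasCompactSupport_smoothing k hc⟩

/-- Asymptotically, mollification commutes with multiplication by a test field. -/
lemma tendsto_pairing_smoothing_sub (μ : VecRadon n) {f : Rn n → ℝ} {M : ℝ}
    (hf : IsBddBorel f M) {φ : Rn n → Rn n} (hφ : IsTestField φ) :
    Tendsto (fun k => μ.pairing (smoothing k fun x => f x • φ x)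
      - ∫ x, smoothing k f x * ⟪φ x, μ.dir x⟫ ∂μ.var) atTop (𝓝 0) := by
  have := μ.locallyFinite
  obtain ⟨K, hK⟩ := hφ.1.lipschitzWith_of_hasCompactSupport hφ.2 (by simp)
  obtain ⟨R, hR⟩ := exists_norm_bound hφ.2
  have hfφ : LocallyIntegrable fun x => f x • φ x :=
    (hf.integrable_smul (hφ.1.continuous.integrable_of_hasCompactSupport hφ.2)).locallyIntegrable
  have hfφc : HasCompactSupport fun x => f x • φ x := HasCompactSupport.smul_left (f := f) hφ.2
  set B := closedBall (0 : Rn n) (R + 1)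
  have hlim : Tendsto (fun k => μ.var.real B * (M * (K * (bump n k).rOut))) atTop (𝓝 0) := by
    simpa using (((tendsto_bump_rOut n).const_mul (K : ℝ)).const_mul M).const_mul (μ.var.real B)
  refine squeeze_zero_norm (fun k => ?_) hlim
  have i1 := μ.integrable_inner (isTestField_smoothing hfφ hfφc k).1.continuous
    (isTestField_smoothing hfφ hfφc k).2
  have i2 := (isBddBorel_smoothing hf k).integrable_mul
    (μ.integrable_inner hφ.1.continuous hφ.2)
  have hb : Integrable (B.indicator fun _ => M * (K * (bump n k).rOut)) μ.var :=
    (integrable_indicator_iff measurableSet_closedBall).2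
      (integrableOn_const (isCompact_closedBall _ _).measure_lt_top.ne)
  have hbi : ∫ x, B.indicator (fun _ => M * (K * (bump n k).rOut)) x ∂μ.var
      = μ.var.real B * (M * (K * (bump n k).rOut)) := by
    rw [integral_indicator measurableSet_closedBall, setIntegral_const, smul_eq_mul]
  rw [VecRadon.pairing, ← integral_sub i1 i2, ← hbi]
  refine norm_integral_le_of_norm_le hb (μ.norm_dir.mono fun x hx => ?_)
  by_cases hxB : x ∈ B
  · rw [indicator_of_mem hxB, ← real_inner_smul_left, ← inner_sub_left]
    refine (norm_inner_le_norm _ _).trans ?_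
    rw [hx, mul_one]
    -- Only the oscillation of `φ` over the mollification radius enters, so no continuity of `f` is
    -- needed.
    refine norm_smoothing_smul_sub_le k hf.locallyIntegrable hfφ hf.2 fun y hy => ?_
    have := hK.dist_le_mul y x
    rw [dist_eq_norm, dist_eq_norm, norm_sub_rev y x] at this
    exact this.trans (by gcongr)
  · have hx' : R + 1 < ‖x‖ := by simpa [B] using hxB
    rw [indicator_of_notMem hxB,
      smoothing_eq_zero k (fun y hy => by rw [hR y hy, smul_zero]) hx'.le, hR x (by linarith)]
    simp

lemma tendsto_integral_mul_smoothing {f g : Rn n → ℝ} {M N : ℝ} (hf : IsBddBorel f M)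
    (hg : IsBddBorel g N) {w : Rn n → ℝ} (hw : Integrable w) :
    Tendsto (fun k => ∫ x, f x * smoothing k g x * w x) atTop (𝓝 (∫ x, f x * g x * w x)) := by
  refine tendsto_integral_of_dominated_convergence (fun x => M * N * ‖w x‖)
    (fun k => ((hf.mul (isBddBorel_smoothing hg k)).integrable_mul hw).aestronglyMeasurable)
    (hw.norm.const_mul _) (fun k => ae_of_all _ fun x => ?_) ?_
  · rw [norm_mul]
    exact mul_le_mul_of_nonneg_right ((hf.mul (isBddBorel_smoothing hg k)).2 x) (norm_nonneg _)
  · filter_upwards [ae_tendsto_smoothing hg.locallyIntegrable] with x hx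
    exact (hx.const_mul _).mul_const _

/-- The shear `(x, h) ↦ (x, x + h)` preserves Lebesgue measure, so null sets pull back to null sets;
this handles both endpoints of an increment. -/
lemma ae_prod_add {p : Rn n → Prop} (hp : ∀ᵐ x, p x) :
    ∀ᵐ q : Rn n × Rn n ∂(volume.prod volume), p q.1 ∧ p (q.1 + q.2) := by
  have h1 := (Measure.quasiMeasurePreserving_fst (μ := (volume : Measure (Rn n)))
    (ν := (volume : Measure (Rn n)))).ae hp
  have h2 := (measurePreserving_prod_add volume (volume : Measure (Rn n))).quasiMeasurePreserving
  have h3 := (Measure.quasiMeasurePreserving_snd (μ := (volume : Measure (Rn n)))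
    (ν := (volume : Measure (Rn n)))).comp h2
  filter_upwards [h1, h3.ae hp] with q hq hq'
  exact ⟨hq, hq'⟩

/-- Increments of `ρ_k * g` are bounded by `2 * N` uniformly in `k`, which yields one integrable
majorant for dominated convergence. -/
lemma tendsto_integral_mul_fracDivNL_smoothing (hn : 1 ≤ n) {α : ℝ} (hα : α ∈ Ioo (0 : ℝ) 1)
    {f g : Rn n → ℝ} {M N : ℝ} (hf : IsBddBorel f M) (hg : IsBddBorel g N)
    {φ : Rn n → Rn n} (hφ : IsTestField φ) :
    Tendsto (fun k => ∫ x, f x * fracDivNL α (smoothing k g) φ x) atTop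
      (𝓝 (∫ x, f x * fracDivNL α g φ x)) := by
  rw [(integral_mul_fracDivNL hn hα hf hg hφ).2]
  simp only [fun k => (integral_mul_fracDivNL hn hα hf (isBddBorel_smoothing hg k) hφ).2]
  refine Tendsto.const_mul _ ?_
  refine tendsto_integral_of_dominated_convergence
    (fun p => M * (2 * N * ‖⟪φ (p.1 + p.2) - φ p.1, ker α p.2⟫‖))
    (fun k => (integrable_nl hn hα hf (isBddBorel_smoothing hg k) hφ).aestronglyMeasurable)
    (((integrable_inner_ker hn hα hφ).norm.const_mul _).const_mul _)
    (fun k => ae_of_all _ fun p => ?_) ?_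
  · rw [norm_mul, norm_mul]
    exact mul_le_mul (hf.2 _) (mul_le_mul_of_nonneg_right
      ((isBddBorel_smoothing hg k).sub_norm_le _ _) (norm_nonneg _)) (by positivity) hf.nonneg
  · filter_upwards [ae_prod_add (ae_tendsto_smoothing hg.locallyIntegrable)] with p hp
    exact ((hp.2.sub hp.1).mul_const _).const_mul _

/-- The Leibniz rule in weak form, with the traces `fbar` and `gbar`. -/
lemma exists_weak_leibniz (hn : 1 ≤ n) {α : ℝ} (hα : α ∈ Ioo (0 : ℝ) 1)
    {f g : Rn n → ℝ} {M N : ℝ} (hf : IsBddBorel f M) (hg : IsBddBorel g N)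
    {Df Dg : VecRadon n} (hDf : IsFracVariation α f Df) (hDg : IsFracVariation α g Dg) :
    ∃ fbar gbar : Rn n → ℝ, IsBddBorel fbar M ∧ IsBddBorel gbar N ∧
      (∀ᵐ x ∂Dg.var, ∀ l : ℝ, HasPreciseValue f x l → fbar x = l) ∧
      (∀ᵐ x ∂Df.var, ∀ l : ℝ, HasPreciseValue g x l → gbar x = l) ∧
      ∀ φ, IsTestField φ → ∫ x, f x * g x * fracDiv α φ x
        = -(∫ x, gbar x * ⟪φ x, Df.dir x⟫ ∂Df.var) - (∫ x, fbar x * ⟪φ x, Dg.dir x⟫ ∂Dg.var)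
          - ∫ x, f x * fracDivNL α g φ x := by
  have := Df.locallyFinite
  have := Dg.locallyFinite
  obtain ⟨fbar, f1, f2, f3, f4⟩ := exists_weakStar_limit Dg.var hf.nonneg
    (fun k => (isBddBorel_smoothing hf k).1) (fun k => (isBddBorel_smoothing hf k).2)
  obtain ⟨gbar, g1, g2, g3, g4⟩ := exists_weakStar_limit Df.var hg.nonneg
    (fun k => (isBddBorel_smoothing hg k).1) (fun k => (isBddBorel_smoothing hg k).2)
  refine ⟨fbar, gbar, ⟨f1, f2⟩, ⟨g1, g2⟩, f4.mono fun x hx l hl => hx l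
    (tendsto_smoothing_of_hasPreciseValue hf.locallyIntegrable hf.2 hl), g4.mono fun x hx l hl =>
    hx l (tendsto_smoothing_of_hasPreciseValue hg.locallyIntegrable hg.2 hl), fun φ hφ => ?_⟩
  have hfφ : LocallyIntegrable fun x => f x • φ x :=
    (hf.integrable_smul (hφ.1.continuous.integrable_of_hasCompactSupport hφ.2)).locallyIntegrable
  have hfφc : HasCompactSupport fun x => f x • φ x := HasCompactSupport.smul_left (f := f) hφ.2
  have hu := Nat.hyperfilter_le_atTop
  have t1 := g3 _ (Df.integrable_inner hφ.1.continuous hφ.2)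
  have t2 := ((tendsto_pairing_smoothing_sub Dg hf hφ).mono_left hu).add
    (f3 _ (Dg.integrable_inner hφ.1.continuous hφ.2))
  have t3 := (tendsto_integral_mul_fracDivNL_smoothing hn hα hf hg hφ).mono_left hu
  have t0 := (tendsto_integral_mul_smoothing hf hg (integrable_fracDiv hn hα hφ)).mono_left hu
  -- Solve the mollified rule for `∫ f g_k div^α φ` and compare its two limits along the
  -- ultrafilter.
  refine tendsto_nhds_unique t0 (((t1.neg.sub t2).sub t3).congr' ?_ |>.trans_eq ?_)
  · refine Eventually.of_forall fun k => ?_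
    have e := integral_mul_fracDiv_smoothing_smul hn hα hf hg hφ k
    rw [hDg _ (isTestField_smoothing hfφ hfφc k),
      hDf _ (hφ.smul (contDiff_smoothing k hg.locallyIntegrable))] at e
    have e2 : Df.pairing (fun x => smoothing k g x • φ x)
        = ∫ x, smoothing k g x * ⟪φ x, Df.dir x⟫ ∂Df.var := by
      simp only [VecRadon.pairing, real_inner_smul_left]
    rw [e2] at e
    linarith
  · rw [zero_add]

end

/-! ### Bounded representatives, existence of the variation measure, and identities between
measures. -/

section

open Metric

variable {n : ℕ}

/-- Every `L^∞` function has a Borel representative bounded by its norm. -/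
lemma exists_isBddBorel_ae_eq {f : Rn n → ℝ} (hf : MemLp f ∞ volume) :
    ∃ f', IsBddBorel f' (eLpNorm f ∞ volume).toReal ∧ f =ᵐ[volume] f' := by
  obtain ⟨f₀, hm, he⟩ := hf.aestronglyMeasurable
  set M := (eLpNorm f ∞ volume).toReal
  have hM : ∀ᵐ x, |f x| ≤ M := by
    filter_upwards [ae_le_eLpNormEssSup (f := f) (μ := volume)] with x hx
    have h1 : ‖f x‖ₑ.toReal ≤ M := by
      refine ENNReal.toReal_mono hf.eLpNorm_ne_top ?_
      rwa [eLpNorm_exponent_top]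
    simpa using h1
  have hs : MeasurableSet {x | |f₀ x| ≤ M} :=
    measurableSet_le hm.measurable.abs measurable_const
  refine ⟨{x | |f₀ x| ≤ M}.indicator f₀, ⟨hm.measurable.indicator hs, fun x => ?_⟩, ?_⟩
  · by_cases hx : |f₀ x| ≤ M
    · rw [indicator_of_mem (by exact hx)]; exact hx
    · rw [indicator_of_notMem (by exact hx)]; simp [M]
  · filter_upwards [hM, he] with x hx hx'
    rw [indicator_of_mem (by change |f₀ x| ≤ M; rwa [← hx']), hx']

lemma IsBddBorel.memLp {f : Rn n → ℝ} {M : ℝ} (hf : IsBddBorel f M) (ν : Measure (Rn n)) :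
    MemLp f ∞ ν := memLp_top_of_bound hf.1.aestronglyMeasurable M (ae_of_all _ hf.2)

lemma IsBddBorel.eLpNorm_le {f : Rn n → ℝ} {M : ℝ} (hf : IsBddBorel f M) (ν : Measure (Rn n)) :
    eLpNorm f ∞ ν ≤ ENNReal.ofReal M := by
  rw [eLpNorm_exponent_top]
  exact eLpNormEssSup_le_of_ae_bound (ae_of_all _ hf.2)

lemma integral_mul_fracDiv_congr {f f' : Rn n → ℝ} (h : f =ᵐ[volume] f') (α : ℝ)
    (φ : Rn n → Rn n) : ∫ x, f x * fracDiv α φ x = ∫ x, f' x * fracDiv α φ x :=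
  integral_congr_ae (h.mono fun x hx => by simp only [hx])

lemma memBVLoc_congr {f f' : Rn n → ℝ} (h : f =ᵐ[volume] f') (α : ℝ) (p : ℝ≥0∞) :
    MemBVLoc α p f ↔ MemBVLoc α p f' := by
  simp only [MemBVLoc, memLp_congr_ae h, integral_mul_fracDiv_congr h]

lemma isFracVariation_congr {f f' : Rn n → ℝ} (h : f =ᵐ[volume] f') (α : ℝ) (μ : VecRadon n) :
    IsFracVariation α f μ ↔ IsFracVariation α f' μ := by
  simp only [IsFracVariation, integral_mul_fracDiv_congr h]

lemma fracDivNL_congr {g g' : Rn n → ℝ} (h : g =ᵐ[volume] g') (α : ℝ) (φ : Rn n → Rn n) :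
    fracDivNL α g φ =ᵐ[volume] fracDivNL α g' φ := by
  filter_upwards [h] with x hx
  simp only [fracDivNL]
  congr 1
  exact integral_congr_ae (h.mono fun y hy => by simp only [hx, hy])

lemma isNLGradient_congr {f f' g g' : Rn n → ℝ} (hf : f =ᵐ[volume] f') (hg : g =ᵐ[volume] g')
    (α : ℝ) (μ : VecRadon n) : IsNLGradient α f g μ ↔ IsNLGradient α f' g' μ := by
  have e : ∀ φ : Rn n → Rn n, ∫ x, f x * fracDivNL α g φ x = ∫ x, f' x * fracDivNL α g' φ x :=
    fun φ => integral_congr_ae (by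
      filter_upwards [hf, fracDivNL_congr hg α φ] with x h1 h2
      rw [h1, h2])
  simp only [IsNLGradient, e]

lemma hasPreciseValue_congr {f f' : Rn n → ℝ} (h : f =ᵐ[volume] f') (x : Rn n) (l : ℝ) :
    HasPreciseValue f x l ↔ HasPreciseValue f' x l := by
  simp only [HasPreciseValue, fun r : ℝ => average_congr (ae_restrict_of_ae (s := ball x r) h)]

lemma IsTestField.const_smul {φ : Rn n → Rn n} (hφ : IsTestField φ) (c : ℝ) :
    IsTestField fun x => c • φ x := hφ.smul (u := fun _ => c) contDiff_const

/-- Existence of the fractional variation measure. -/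
lemma exists_isFracVariation (hn : 1 ≤ n) {α : ℝ} (hα : α ∈ Ioo (0 : ℝ) 1) {f : Rn n → ℝ} {M : ℝ}
    (hf : IsBddBorel f M) (hBV : MemBVLoc α ∞ f) : ∃ μ : VecRadon n, IsFracVariation α f μ := by
  have hadd : ∀ φ ψ, IsTestField φ → IsTestField ψ →
      -∫ x, f x * fracDiv α (fun x => φ x + ψ x) x
        = (-∫ x, f x * fracDiv α φ x) + -∫ x, f x * fracDiv α ψ x := fun φ ψ hφ hψ => by
    simp only [fracDiv_add hn hα hφ hψ, mul_add]
    rw [integral_add (hf.integrable_mul (integrable_fracDiv hn hα hφ))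
      (hf.integrable_mul (integrable_fracDiv hn hα hψ))]
    ring
  have hsmul : ∀ (c : ℝ) φ, ∫ x, f x * fracDiv α (fun x => c • φ x) x
      = c * ∫ x, f x * fracDiv α φ x := fun c φ => by
    simp only [fracDiv_const_smul, mul_left_comm _ c, integral_const_mul]
  obtain ⟨μ, hμ⟩ := exists_vecRadon_of_locallyBounded
    (fun φ => -∫ x, f x * fracDiv α φ x) hadd (fun c φ _ => by simp only [hsmul]; ring) (by
      intro R
      -- Radius `R + 1` gives an open bounded set containing the closed ball in which `φ` is
      -- supported.
      obtain ⟨C, hC⟩ := hBV.2 (ball 0 (R + 1)) isOpen_ball isBounded_ball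
      refine ⟨C, fun φ hφ hR c hc => ?_⟩
      have hsupp : tsupport φ ⊆ ball 0 (R + 1) := by
        refine (closure_minimal (fun x hx => ?_) isClosed_closedBall).trans
          (closedBall_subset_ball (by linarith : R < R + 1))
        rw [mem_closedBall_zero_iff]
        by_contra h
        exact hx (hR x (not_le.1 h).le)
      have hc0 : 0 ≤ c := (norm_nonneg _).trans (hc 0)
      rcases hc0.eq_or_lt with rfl | hc0
      · have hz : φ = fun x => (0 : ℝ) • φ x := by
          ext1 x
          rw [zero_smul]
          exact norm_le_zero_iff.1 (hc x)
        rw [hz, hsmul]; simp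
      -- The definition bounds a one-sided supremum; testing with both `φ / c` and `-φ / c` bounds
      -- the absolute value.
      · have key : ∀ t : ℝ, |t| = 1 → t * (∫ x, f x * fracDiv α φ x) ≤ C * c := by
          intro t ht
          have h1 : (t / c) * (∫ x, f x * fracDiv α φ x) ≤ C := by
            refine hC ⟨_, hφ.const_smul (t / c), fun x => ?_, ?_, (hsmul _ _).symm⟩
            · rw [norm_smul, norm_div, Real.norm_eq_abs, ht, Real.norm_of_nonneg hc0.le,
                one_div, inv_mul_le_iff₀ hc0, mul_one]
              exact hc x
            · exact (closure_mono (Function.support_const_smul_subset (t / c) φ)).trans hsupp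
          calc _ = (t / c * ∫ x, f x * fracDiv α φ x) * c := by field_simp
            _ ≤ C * c := by gcongr
        have h1 := key 1 (by simp)
        have h2 := key (-1) (by simp)
        rw [abs_neg, abs_le]
        constructor <;> linarith)
  exact ⟨μ, fun φ hφ => by rw [← hμ φ hφ, neg_neg]⟩

/-- This bounds the measure terms of the weak Leibniz rule uniformly over the admissible fields
supported in `A`, so that `f g` has bounded variation there. -/
lemma abs_integral_mul_inner_le (μ : VecRadon n) {h : Rn n → ℝ} {M : ℝ} (hh : IsBddBorel h M)
    {A : Set (Rn n)} (hA : IsOpen A) (hAb : Bornology.IsBounded A) {φ : Rn n → Rn n}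
    (hφ : ∀ x, ‖φ x‖ ≤ 1) (hs : tsupport φ ⊆ A) :
    |∫ x, h x * ⟪φ x, μ.dir x⟫ ∂μ.var| ≤ M * μ.var.real A := by
  have := μ.locallyFinite
  have hi : Integrable (A.indicator fun _ => M) μ.var :=
    (integrable_indicator_iff hA.measurableSet).2 (integrableOn_const hAb.measure_lt_top.ne)
  have e : ∫ x, A.indicator (fun _ => M) x ∂μ.var = M * μ.var.real A := by
    rw [integral_indicator hA.measurableSet, setIntegral_const, smul_eq_mul, mul_comm]
  rw [← e, ← Real.norm_eq_abs]
  refine norm_integral_le_of_norm_le hi (μ.norm_dir.mono fun x hx => ?_)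
  by_cases hxA : x ∈ A
  · rw [indicator_of_mem hxA, norm_mul]
    have h1 : ‖⟪φ x, μ.dir x⟫‖ ≤ 1 := by
      refine (norm_inner_le_norm _ _).trans ?_
      rw [hx, mul_one]; exact hφ x
    calc ‖h x‖ * ‖⟪φ x, μ.dir x⟫‖ ≤ M * 1 :=
          mul_le_mul (hh.2 x) h1 (norm_nonneg _) hh.nonneg
      _ = M := mul_one M
  · rw [indicator_of_notMem hxA, image_eq_zero_of_notMem_tsupport fun h => hxA (hs h)]
    simp

lemma isBddBorel_one : IsBddBorel (fun _ : Rn n => (1 : ℝ)) 1 := ⟨measurable_const, by simp⟩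

/-- A common dominating measure of finitely many vector measures, with Borel densities. -/
lemma exists_common_densities {ι : Type*} [Fintype ι] (μ : ι → VecRadon n) {h : ι → Rn n → ℝ}
    {M : ι → ℝ} (hh : ∀ i, IsBddBorel (h i) (M i)) :
    ∃ (ν : Measure (Rn n)) (d : ι → Rn n → Rn n), IsLocallyFiniteMeasure ν ∧
      (∀ i, Measurable (d i)) ∧ (∀ i x, ‖d i x‖ ≤ M i) ∧
      (∀ i (φ : Rn n → Rn n),
        ∫ x, h i x * ⟪φ x, (μ i).dir x⟫ ∂(μ i).var = ∫ x, ⟪φ x, d i x⟫ ∂ν) ∧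
      ∀ i B, MeasurableSet B → (μ i).mulVal (h i) B = ∫ x in B, d i x ∂ν := by
  let ν : Measure (Rn n) := Measure.sum fun i => (μ i).var
  have hl := fun i => (μ i).locallyFinite
  have hν : IsLocallyFiniteMeasure ν := by
    have : IsFiniteMeasureOnCompacts ν := by
      refine ⟨fun K hK => ?_⟩
      rw [Measure.sum_apply _ hK.isClosed.measurableSet, tsum_fintype]
      exact ENNReal.sum_lt_top.2 fun i _ => hK.measure_lt_top
    infer_instance
  choose d h1 h2 h3 h4 using fun i =>
    (μ i).exists_density (ν := ν) (Measure.le_sum (fun i => (μ i).var) i) (hh i)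
  exact ⟨ν, d, hν, h1, h2, h3, h4⟩

lemma integrable_inner_of_bound {ν : Measure (Rn n)} [IsLocallyFiniteMeasure ν]
    {d : Rn n → Rn n} (hd : Measurable d) {C : ℝ} (hC : ∀ x, ‖d x‖ ≤ C) {φ : Rn n → Rn n}
    (hφ : IsTestField φ) : Integrable (fun x => ⟪φ x, d x⟫) ν := by
  refine ((hφ.1.continuous.norm.integrable_of_hasCompactSupport hφ.2.norm).mul_const C).mono'
    (hφ.1.continuous.measurable.inner hd).aestronglyMeasurable (ae_of_all _ fun x => ?_)
  exact (norm_inner_le_norm _ _).trans (mul_le_mul_of_nonneg_left (hC x) (norm_nonneg _))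

lemma VecRadon.integral_one_mul (μ : VecRadon n) (φ : Rn n → Rn n) :
    ∫ x, (fun _ => (1 : ℝ)) x * ⟪φ x, μ.dir x⟫ ∂μ.var = μ.pairing φ := by
  simp [VecRadon.pairing]

/-- A combination `μ₀ - h₁ μ₁ - h₂ μ₂` of vector Radon measures is a vector Radon measure. -/
lemma exists_vecRadon_sub_sub (μ₀ μ₁ μ₂ : VecRadon n) {h₁ h₂ : Rn n → ℝ} {M₁ M₂ : ℝ}
    (hh₁ : IsBddBorel h₁ M₁) (hh₂ : IsBddBorel h₂ M₂) :
    ∃ μ : VecRadon n, ∀ φ, IsTestField φ → μ.pairing φ = μ₀.pairing φ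
      - (∫ x, h₁ x * ⟪φ x, μ₁.dir x⟫ ∂μ₁.var) - ∫ x, h₂ x * ⟪φ x, μ₂.dir x⟫ ∂μ₂.var := by
  obtain ⟨ν, d, hν, hm, hb, hp, -⟩ := exists_common_densities ![μ₀, μ₁, μ₂]
    (h := ![fun _ => 1, h₁, h₂]) (M := ![1, M₁, M₂]) (fun i => by
      fin_cases i
      exacts [isBddBorel_one, hh₁, hh₂])
  obtain ⟨μ, hμ⟩ := exists_vecRadon_of_density ν (d := fun x => d 0 x - d 1 x - d 2 x)
    (C := 1 + M₁ + M₂) (((hm 0).sub (hm 1)).sub (hm 2)) (fun x => by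
      have h0 : ‖d 0 x‖ ≤ 1 := hb 0 x
      have h1 : ‖d 1 x‖ ≤ M₁ := hb 1 x
      have h2 : ‖d 2 x‖ ≤ M₂ := hb 2 x
      linarith [norm_sub_le (d 0 x - d 1 x) (d 2 x), norm_sub_le (d 0 x) (d 1 x)])
  refine ⟨μ, fun φ hφ => ?_⟩
  have i := fun i => integrable_inner_of_bound (ν := ν) (hm i) (hb i) hφ
  have p0 := hp 0 φ
  have p1 : ∫ x, h₁ x * ⟪φ x, μ₁.dir x⟫ ∂μ₁.var = _ := hp 1 φ
  have p2 : ∫ x, h₂ x * ⟪φ x, μ₂.dir x⟫ ∂μ₂.var = _ := hp 2 φ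
  have p0' : μ₀.pairing φ = ∫ x, ⟪φ x, d 0 x⟫ ∂ν := by
    rw [← p0]; exact (μ₀.integral_one_mul φ).symm
  have i01 : Integrable (fun x => ⟪φ x, d 0 x⟫ - ⟪φ x, d 1 x⟫) ν := (i 0).sub (i 1)
  rw [hμ, p0', p1, p2, ← integral_sub (i 0) (i 1), ← integral_sub i01 (i 2)]
  simp only [inner_sub_right]

/-- A linear relation between pairings with test fields holds for the measures. -/
lemma val_eq_of_forall_pairing_eq (μ₀ μ₁ μ₂ μ₃ : VecRadon n) {h₁ h₂ : Rn n → ℝ} {M₁ M₂ : ℝ}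
    (hh₁ : IsBddBorel h₁ M₁) (hh₂ : IsBddBorel h₂ M₂)
    (h : ∀ φ, IsTestField φ → μ₀.pairing φ = (∫ x, h₁ x * ⟪φ x, μ₁.dir x⟫ ∂μ₁.var)
      + (∫ x, h₂ x * ⟪φ x, μ₂.dir x⟫ ∂μ₂.var) + μ₃.pairing φ)
    {B : Set (Rn n)} (hB : MeasurableSet B) (hBb : Bornology.IsBounded B) :
    μ₀.val B = VecRadon.mulVal h₁ μ₁ B + VecRadon.mulVal h₂ μ₂ B + μ₃.val B := by
  obtain ⟨ν, d, hν, hm, hb, hp, hv⟩ := exists_common_densities ![μ₀, μ₁, μ₂, μ₃]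
    (h := ![fun _ => 1, h₁, h₂, fun _ => 1]) (M := ![1, M₁, M₂, 1]) (fun i => by
      fin_cases i
      exacts [isBddBorel_one, hh₁, hh₂, isBddBorel_one])
  -- Test fields determine bounded densities, so the relation holds `ν`-a.e. and may then be
  -- integrated over any bounded Borel set.
  have hz : ∀ᵐ x ∂ν, d 0 x - d 1 x - d 2 x - d 3 x = 0 := by
    refine ae_eq_zero_of_forall_integral_inner (C := 1 + M₁ + M₂ + 1)
      ((((hm 0).sub (hm 1)).sub (hm 2)).sub (hm 3)) (fun x => ?_) fun φ hφ => ?_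
    · have h0 : ‖d 0 x‖ ≤ 1 := hb 0 x
      have h1 : ‖d 1 x‖ ≤ M₁ := hb 1 x
      have h2 : ‖d 2 x‖ ≤ M₂ := hb 2 x
      have h3 : ‖d 3 x‖ ≤ 1 := hb 3 x
      linarith [norm_sub_le (d 0 x - d 1 x - d 2 x) (d 3 x),
        norm_sub_le (d 0 x - d 1 x) (d 2 x), norm_sub_le (d 0 x) (d 1 x)]
    · have i := fun i => integrable_inner_of_bound (ν := ν) (hm i) (hb i) hφ
      have p0 : μ₀.pairing φ = ∫ x, ⟪φ x, d 0 x⟫ ∂ν := by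
        rw [← hp 0 φ]; exact (μ₀.integral_one_mul φ).symm
      have p1 : ∫ x, h₁ x * ⟪φ x, μ₁.dir x⟫ ∂μ₁.var = ∫ x, ⟪φ x, d 1 x⟫ ∂ν := hp 1 φ
      have p2 : ∫ x, h₂ x * ⟪φ x, μ₂.dir x⟫ ∂μ₂.var = ∫ x, ⟪φ x, d 2 x⟫ ∂ν := hp 2 φ
      have p3 : μ₃.pairing φ = ∫ x, ⟪φ x, d 3 x⟫ ∂ν := by
        rw [← hp 3 φ]; exact (μ₃.integral_one_mul φ).symm
      have i01 : Integrable (fun x => ⟪φ x, d 0 x⟫ - ⟪φ x, d 1 x⟫) ν := (i 0).sub (i 1)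
      have i012 : Integrable (fun x => ⟪φ x, d 0 x⟫ - ⟪φ x, d 1 x⟫ - ⟪φ x, d 2 x⟫) ν :=
        i01.sub (i 2)
      simp only [inner_sub_right]
      rw [integral_sub i012 (i 3), integral_sub i01 (i 2), integral_sub (i 0) (i 1), ← p0, ← p1,
        ← p2, ← p3, h φ hφ]
      ring
  have j : ∀ i, Integrable (d i) (ν.restrict B) := fun i =>
    Measure.integrableOn_of_bounded hBb.measure_lt_top.ne (hm i).aestronglyMeasurable
      (ae_of_all _ (hb i))
  have v0 : μ₀.val B = ∫ x in B, d 0 x ∂ν := by rw [← hv 0 B hB]; exact (μ₀.mulVal_one B).symm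
  have v1 : VecRadon.mulVal h₁ μ₁ B = ∫ x in B, d 1 x ∂ν := hv 1 B hB
  have v2 : VecRadon.mulVal h₂ μ₂ B = ∫ x in B, d 2 x ∂ν := hv 2 B hB
  have v3 : μ₃.val B = ∫ x in B, d 3 x ∂ν := by rw [← hv 3 B hB]; exact (μ₃.mulVal_one B).symm
  have j12 : Integrable (fun x => d 1 x + d 2 x) (ν.restrict B) := (j 1).add (j 2)
  rw [v0, v1, v2, v3, ← integral_add (j 1) (j 2), ← integral_add j12 (j 3)]
  refine integral_congr_ae (ae_restrict_of_ae (hz.mono fun x hx => ?_))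
  simp only
  rw [← sub_eq_zero, ← hx]; abel

end

end FracBV

end

/-! ### The conditional Leibniz rule. -/

theorem theorem1p3 (n : ℕ) (hn : 1 ≤ n) (α : ℝ) (hα : α ∈ Set.Ioo (0 : ℝ) 1)
    (f g : FracBV.Rn n → ℝ)
    (hf : FracBV.MemBVLoc α ∞ f) (hg : FracBV.MemBVLoc α ∞ g) :
    (∃ Df : FracBV.VecRadon n, FracBV.IsFracVariation α f Df) ∧
    (∃ Dg : FracBV.VecRadon n, FracBV.IsFracVariation α g Dg) ∧
    (FracBV.MemBVLoc α ∞ (fun x => f x * g x) ↔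
      ∃ N : FracBV.VecRadon n, FracBV.IsNLGradient α f g N) ∧
    ∀ Df Dg : FracBV.VecRadon n,
      FracBV.IsFracVariation α f Df → FracBV.IsFracVariation α g Dg →
      ∃ fbar gbar : FracBV.Rn n → ℝ,
        MemLp fbar ∞ Dg.var ∧ MemLp gbar ∞ Df.var ∧
        eLpNorm fbar ∞ Dg.var ≤ eLpNorm f ∞ volume ∧
        eLpNorm gbar ∞ Df.var ≤ eLpNorm g ∞ volume ∧
        (∀ᵐ x ∂Dg.var, ∀ l : ℝ, FracBV.HasPreciseValue f x l → fbar x = l) ∧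
        (∀ᵐ x ∂Df.var, ∀ l : ℝ, FracBV.HasPreciseValue g x l → gbar x = l) ∧
        (FracBV.MemBVLoc α ∞ (fun x => f x * g x) →
          (∃ Dfg : FracBV.VecRadon n, FracBV.IsFracVariation α (fun x => f x * g x) Dfg) ∧
          ∀ Dfg N : FracBV.VecRadon n,
            FracBV.IsFracVariation α (fun x => f x * g x) Dfg →
            FracBV.IsNLGradient α f g N →
            ∀ B : Set (FracBV.Rn n), MeasurableSet B → Bornology.IsBounded B →
              Dfg.val B = FracBV.VecRadon.mulVal fbar Dg B +
                FracBV.VecRadon.mulVal gbar Df B + N.val B) := by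
  -- All notions involved depend only on a.e. classes, so `f` and `g` may be replaced by Borel
  -- functions bounded everywhere by their `L^∞` norms.
  obtain ⟨f', hf', hff'⟩ := FracBV.exists_isBddBorel_ae_eq hf.1
  obtain ⟨g', hg', hgg'⟩ := FracBV.exists_isBddBorel_ae_eq hg.1
  have hmul : (fun x => f x * g x) =ᵐ[volume] fun x => f' x * g' x := hff'.mul hgg'
  have hfg' := hf'.mul hg'
  simp only [FracBV.isFracVariation_congr hff', FracBV.isFracVariation_congr hgg',
    FracBV.isFracVariation_congr hmul, FracBV.memBVLoc_congr hmul,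
    FracBV.isNLGradient_congr hff' hgg', FracBV.hasPreciseValue_congr hff',
    FracBV.hasPreciseValue_congr hgg']
  obtain ⟨Df₀, hDf₀⟩ := FracBV.exists_isFracVariation hn hα hf'
    ((FracBV.memBVLoc_congr hff' α ∞).1 hf)
  obtain ⟨Dg₀, hDg₀⟩ := FracBV.exists_isFracVariation hn hα hg'
    ((FracBV.memBVLoc_congr hgg' α ∞).1 hg)
  refine ⟨⟨Df₀, hDf₀⟩, ⟨Dg₀, hDg₀⟩, ⟨fun hBV => ?_, ?_⟩, fun Df Dg hDf hDg => ?_⟩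
  · obtain ⟨fbar, gbar, hfb, hgb, -, -, hL⟩ :=
      FracBV.exists_weak_leibniz hn hα hf' hg' hDf₀ hDg₀
    obtain ⟨Dfg, hDfg⟩ := FracBV.exists_isFracVariation hn hα hfg' hBV
    -- The weak Leibniz rule dictates the candidate `D^α(fg) - fbar D^α g - gbar D^α f`.
    obtain ⟨N, hN⟩ := FracBV.exists_vecRadon_sub_sub Dfg Dg₀ Df₀ hfb hgb
    refine ⟨N, fun φ hφ => ?_⟩
    have h1 := hL φ hφ
    have h2 := hDfg φ hφ
    rw [hN φ hφ]
    linarith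
  · rintro ⟨N, hN⟩
    obtain ⟨fbar, gbar, hfb, hgb, -, -, hL⟩ :=
      FracBV.exists_weak_leibniz hn hα hf' hg' hDf₀ hDg₀
    refine ⟨hfg'.memLp volume, fun A hA hAb =>
      ⟨(eLpNorm g ∞ volume).toReal * Df₀.var.real A + (eLpNorm f ∞ volume).toReal * Dg₀.var.real A
        + 1 * N.var.real A, ?_⟩⟩
    rintro _ ⟨φ, hφ, hφ1, hφA, rfl⟩
    have h1 := hL φ hφ
    rw [hN φ hφ, ← N.integral_one_mul] at h1
    have e1 := abs_le.1 (FracBV.abs_integral_mul_inner_le Df₀ hgb hA hAb hφ1 hφA)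
    have e2 := abs_le.1 (FracBV.abs_integral_mul_inner_le Dg₀ hfb hA hAb hφ1 hφA)
    have e3 := abs_le.1
      (FracBV.abs_integral_mul_inner_le N FracBV.isBddBorel_one hA hAb hφ1 hφA)
    rw [h1]
    linarith [e1.1, e2.1, e3.1]
  -- The traces are fixed before anything is assumed about `f g`.
  · obtain ⟨fbar, gbar, hfb, hgb, hfp, hgp, hL⟩ :=
      FracBV.exists_weak_leibniz hn hα hf' hg' hDf hDg
    refine ⟨fbar, gbar, hfb.memLp _, hgb.memLp _, (hfb.eLpNorm_le _).trans_eq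
      (ENNReal.ofReal_toReal hf.1.eLpNorm_ne_top), (hgb.eLpNorm_le _).trans_eq
      (ENNReal.ofReal_toReal hg.1.eLpNorm_ne_top), hfp, hgp, fun hBV =>
      ⟨FracBV.exists_isFracVariation hn hα hfg' hBV, fun Dfg N hDfg hN B hB hBb => ?_⟩⟩
    refine FracBV.val_eq_of_forall_pairing_eq Dfg Dg Df N hfb hgb (fun φ hφ => ?_) hB hBb
    have h1 := hL φ hφ
    have h2 := hDfg φ hφ
    rw [hN φ hφ] at h1
    linarith
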